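/- For vectors $x_1,\dots,x_k\in\mathbb R^d$ write $x_1\otimes\cdots\otimes x_k\in\mathbb R^{d^k}$ for their Kronecker product. A (randomized, adaptive) $q$-query Kronecker-matrix-vector algorithm has a random seed, drawn from an arbitrary probability space independently of the input, and accesses an unknown matrix $A\in\mathbb R^{d^k\times d^k}$ only as follows: for $j=1,\dots,q$ it chooses real vectors $x^{(j)}_1,\dots,x^{(j)}_k\in\mathbb R^d$ as a measurable function of the seed and of the earlier responses $z^{(1)},\dots,z^{(j-1)}$, and receives $z^{(j)}=A\,(x^{(j)}_1\otimes\cdots\otimes x^{(j)}_k)$. Finally it outputs a real number $\hat t=\hat t(A)$ that is a measurable function of the seed and of $z^{(1)},\dots,z^{(q)}$. **Theorem.** There is an absolute constant $c>0$ such that for all integers $k\ge 1$ and all $\varepsilon\in(0,\tfrac12)$ the following hold. 1. (Worst case.) Let $d\ge \sqrt k/\varepsilon$ be an integer. If a $q$-query Kronecker-matrix-vector algorithm satisfies $$\sqrt{\mathbb E\big[(\hat t(A)-\operatorname{tr}(A))^2\big]}\;\le\;\varepsilon\operatorname{tr}(A)$$ for every positive semidefinite $A\in\mathbb R^{d^k\times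 d^k}$, the expectation being over the seed, then $q\ge c\,\sqrt k/\varepsilon$. 2. (Hard instance.) There is an integer $d\le\sqrt k/\varepsilon$ such that the following holds for the random matrix $A=W_1\otimes\cdots\otimes W_k$, where $W_i=G_i^{\mathsf T}G_i$ and $G_1,\dots,G_k\in\mathbb R^{d\times d}$ are independent matrices with i.i.d. standard normal entries (so that the $W_i$ are independent Wishart matrices). If a $q$-query Kronecker-matrix-vector algorithm satisfies $$\sqrt{\mathbb E\big[(\hat t(A)-\operatorname{tr}(A))^2\big]}\;\le\;\varepsilon\,\sqrt{\mathbb E\big[\operatorname{tr}(A)^2\big]},$$ the expectations being over both $A$ and the seed, then $q\ge c\,\sqrt k/\varepsilon$. -/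

import Mathlib

open MeasureTheory ProbabilityTheory

/-- The Kronecker product `x₁ ⊗ ⋯ ⊗ x_k` of vectors `x_i ∈ ℝ^d`. The `d ^ k` coordinates of a vector
in `ℝ^(d^k)` are indexed by the multi-indices `(a₁, …, a_k)` with `a_i < d`. -/
def kronVec {k d : ℕ} (x : Fin k → Fin d → ℝ) : (Fin k → Fin d) → ℝ :=
  fun a => ∏ i, x i (a i)

/-- The Kronecker product `W₁ ⊗ ⋯ ⊗ W_k` of `d × d` matrices, a `d^k × d^k` matrix. -/
def kronMat {k d : ℕ} (W : Fin k → Matrix (Fin d) (Fin d) ℝ) :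
    Matrix (Fin k → Fin d) (Fin k → Fin d) ℝ :=
  Matrix.of fun a b => ∏ i, W i (a i) (b i)

/-- A randomized adaptive algorithm making `q` Kronecker-matrix-vector queries to a `d^k × d^k`
matrix, with random seed in `Ω`. The `j`-th query is given by its `k` factors in `ℝ^d`; these depend
measurably on the seed and on the responses to the earlier queries. The output is a
measurable function of the seed and of all `q` responses. -/
structure KronAlgorithm (Ω : Type*) [MeasurableSpace Ω] (k d q : ℕ) where
  query : (j : Fin q) → Ω → (Fin (j : ℕ) → (Fin k → Fin d) → ℝ) → Fin k → Fin d → ℝ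
  output : Ω → (Fin q → (Fin k → Fin d) → ℝ) → ℝ
  measurable_query : ∀ j, Measurable (Function.uncurry (query j))
  measurable_output : Measurable (Function.uncurry output)

namespace KronAlgorithm

variable {Ω : Type*} [MeasurableSpace Ω] {k d q : ℕ}

/-- The oracle's responses to the first `j` queries when the input matrix is `A` and the seed is
`ω`: the response to the query with factors `x₁, …, x_k` is `A (x₁ ⊗ ⋯ ⊗ x_k)`. -/
def responses (alg : KronAlgorithm Ω k d q) (A : Matrix (Fin k → Fin d) (Fin k → Fin d) ℝ)
    (ω : Ω) : (j : ℕ) → j ≤ q → (Fin j → (Fin k → Fin d) → ℝ)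
  | 0, _ => Fin.elim0
  | j + 1, h =>
      let past := alg.responses A ω j (Nat.le_of_succ_le h)
      Fin.snoc (α := fun _ => (Fin k → Fin d) → ℝ) past
        (A.mulVec (kronVec (alg.query ⟨j, h⟩ ω past)))

/-- The output of the algorithm on input matrix `A` with seed `ω`. -/
def estimate (alg : KronAlgorithm Ω k d q) (A : Matrix (Fin k → Fin d) (Fin k → Fin d) ℝ)
    (ω : Ω) : ℝ :=
  alg.output ω (alg.responses A ω q le_rfl)

end KronAlgorithm

/-- Real matrices carry the product (Borel) sigma-algebra of their entries. -/
instance matrixMeasurableSpace {m n : Type*} : MeasurableSpace (Matrix m n ℝ) :=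
  inferInstanceAs (MeasurableSpace (m → n → ℝ))

/-- The law of a `d × d` matrix with independent standard normal entries. -/
noncomputable def gaussianMatrix (d : ℕ) : Measure (Matrix (Fin d) (Fin d) ℝ) :=
  Measure.pi fun _ => Measure.pi fun _ => gaussianReal 0 1

/-- The `Wishart(d)` law: the law of `Gᵀ G`, with `G` a `d × d` standard Gaussian matrix. -/
noncomputable def wishart (d : ℕ) : Measure (Matrix (Fin d) (Fin d) ℝ) :=
  (gaussianMatrix d).map fun G => G.transpose * G

/-- The law of `W₁ ⊗ ⋯ ⊗ W_k` with `W₁, …, W_k` independent `Wishart(d)` matrices. -/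
noncomputable def kronWishart (k d : ℕ) :
    Measure (Matrix (Fin k → Fin d) (Fin k → Fin d) ℝ) :=
  (Measure.pi fun _ : Fin k => wishart d).map kronMat

/-!
A Kronecker query to `W₁ ⊗ ⋯ ⊗ W_k` reveals no more than one matrix-vector product `Wᵢ xᵢ` for each
factor, so it suffices to bound the number of rounds in which an adaptive estimator asks for one such
product with every factor (`IsAdaptiveEstimator`, `KronAlgorithm.isAdaptiveEstimator`).

Let `W = GᵀG` be a Wishart matrix of dimension `d + 1` and `x` a query. By rotation invariance, `x` may
be taken to be a multiple of `e₀`. A further rotation of the rows of `G`, depending on its first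
column `g`, takes `g` to `‖g‖ e₀` and leaves the other columns standard Gaussian; let `r` be their
first row and `G'` the `d × d` matrix below it. In these coordinates `W` is the rank-one matrix
`w wᵀ` with `w = (‖g‖, r)` plus the Wishart matrix `G'ᵀG'` of dimension `d` on the last `d`
coordinates. The response is a function of `x`, `g` and `r`, independent of `G'ᵀG'`
(`assemble_mulVec`, `measurePreserving_assemble`), and the trace is `‖g‖² + ‖r‖²` plus the trace of
`G'ᵀG'`. The law of the revealed part does not depend on `x`, so adaptivity does not help.

After `q` queries, with `n = d - q` for the original dimension `d`, each trace is thus a known amount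
plus the trace of an independent Wishart matrix of dimension `n`, whose variance is `2 n²`. As the
second moment of `tr Wᵢ` is `d⁴ + 2 d²`, the mean squared error is at least
`(d⁴ + 2 d²)ᵏ - (d⁴ + 2 d² - 2 n²)ᵏ` (`IsAdaptiveEstimator.errorBound_le`). For `n ≥ d / 2` this is
more than `ε²` times the second moment `(d⁴ + 2 d²)ᵏ` of the trace as soon as `d` is a small enough
multiple of `√k / ε` (`IsAdaptiveEstimator.le_queries`). The worst-case bound follows by padding the
hard instance with zeros and averaging.
-/

open scoped Matrix

/-! ### Rotation invariance of Gaussian vectors and matrices -/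

/-- The standard Gaussian law on `ℝ^ι`. -/
noncomputable abbrev gaussianVec (ι : Type*) [Fintype ι] : Measure (ι → ℝ) :=
  Measure.pi fun _ => gaussianReal 0 1

/-- The law of an `m × n` matrix with independent standard normal entries. -/
noncomputable abbrev gaussianRect (m n : Type*) [Fintype m] [Fintype n] : Measure (m → n → ℝ) :=
  Measure.pi fun _ => gaussianVec n

theorem measurePreserving_gaussianVec {ι : Type*} [Fintype ι] (f : (ι → ℝ) →ₗ[ℝ] (ι → ℝ))
    (hf : ∀ x, ∑ i, f x i ^ 2 = ∑ i, x i ^ 2) :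
    MeasurePreserving f (gaussianVec ι) (gaussianVec ι) := by
  let e := WithLp.linearEquiv 2 ℝ (ι → ℝ)
  let g : EuclideanSpace ℝ ι →ₗᵢ[ℝ] EuclideanSpace ℝ ι :=
    { toLinearMap := e.symm.toLinearMap ∘ₗ f ∘ₗ e.toLinearMap
      norm_map' := fun x => by
        rw [EuclideanSpace.norm_eq, EuclideanSpace.norm_eq]
        congr 1
        simp only [Real.norm_eq_abs, sq_abs]
        exact hf x.ofLp }
  let G := g.toLinearIsometryEquiv rfl
  have hm : Measurable f := (LinearMap.continuous_of_finiteDimensional f).measurable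
  have h1 := stdGaussian_map (E := EuclideanSpace ℝ ι) G
  have hG : Measurable G := G.continuous.measurable
  have ht : Measurable (WithLp.toLp 2 : (ι → ℝ) → EuclideanSpace ℝ ι) := by fun_prop
  have ho : Measurable (WithLp.ofLp : EuclideanSpace ℝ ι → (ι → ℝ)) := by fun_prop
  refine ⟨hm, ?_⟩
  rw [← map_pi_eq_stdGaussian, Measure.map_map hG ht] at h1
  have h2 := congrArg (Measure.map (WithLp.ofLp : EuclideanSpace ℝ ι → (ι → ℝ))) h1
  rw [Measure.map_map ho (hG.comp ht), Measure.map_map ho ht] at h2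
  have h3 : (WithLp.ofLp ∘ (WithLp.toLp 2 : (ι → ℝ) → EuclideanSpace ℝ ι)) = id := rfl
  have h4 : (WithLp.ofLp ∘ (G ∘ (WithLp.toLp 2 : (ι → ℝ) → EuclideanSpace ℝ ι))) = f := rfl
  rwa [h3, h4, Measure.map_id] at h2

theorem measurePreserving_gaussianRect {m n : Type*} [Fintype m] [Fintype n]
    (f : (m → n → ℝ) →ₗ[ℝ] (m → n → ℝ))
    (hf : ∀ x, ∑ i, ∑ j, f x i j ^ 2 = ∑ i, ∑ j, x i j ^ 2) :
    MeasurePreserving f (gaussianRect m n) (gaussianRect m n) := by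
  have hc : MeasurePreserving (MeasurableEquiv.curry m n ℝ) (gaussianVec (m × n))
      (gaussianRect m n) := by
    refine ⟨MeasurableEquiv.measurable _, ?_⟩
    have := Measure.infinitePi_map_curry (fun (_ : m) (_ : n) => gaussianReal 0 1)
    simpa only [Measure.infinitePi_eq_pi] using this
  let e := LinearEquiv.curry ℝ ℝ m n
  have h := measurePreserving_gaussianVec (e.symm.toLinearMap ∘ₗ f ∘ₗ e.toLinearMap) (fun x => by
    rw [Fintype.sum_prod_type, Fintype.sum_prod_type]
    exact hf (Function.curry x))
  have := hc.comp (h.comp (hc.symm _))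
  exact this

theorem measurable_matrix {α m n : Type*} [MeasurableSpace α] {f : α → Matrix m n ℝ}
    (h : ∀ i j, Measurable fun a => f a i j) : Measurable f :=
  measurable_pi_iff.2 fun i => measurable_pi_iff.2 fun j => h i j

theorem Measurable.matrix_entry {α m n : Type*} [MeasurableSpace α] {f : α → Matrix m n ℝ}
    (h : Measurable f) (i : m) (j : n) : Measurable fun a => f a i j :=
  measurable_pi_iff.1 (measurable_pi_iff.1 h i) j

theorem Measurable.matrix_mul {α l m n : Type*} [MeasurableSpace α] [Fintype m]
    {f : α → Matrix l m ℝ} {g : α → Matrix m n ℝ} (hf : Measurable f) (hg : Measurable g) :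
    Measurable fun a => f a * g a :=
  measurable_matrix fun i j => by
    simp only [Matrix.mul_apply]
    exact Finset.measurable_sum _ fun c _ => (hf.matrix_entry i c).mul (hg.matrix_entry c j)

theorem Measurable.matrix_add {α m n : Type*} [MeasurableSpace α]
    {f g : α → Matrix m n ℝ} (hf : Measurable f) (hg : Measurable g) :
    Measurable fun a => f a + g a :=
  measurable_matrix fun i j => (hf.matrix_entry i j).add (hg.matrix_entry i j)

theorem Measurable.matrix_transpose {α m n : Type*} [MeasurableSpace α]
    {f : α → Matrix m n ℝ} (hf : Measurable f) : Measurable fun a => (f a)ᵀ :=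
  measurable_matrix fun i j => hf.matrix_entry j i

theorem Measurable.matrix_mulVec {α m n : Type*} [MeasurableSpace α] [Fintype n]
    {f : α → Matrix m n ℝ} {g : α → n → ℝ} (hf : Measurable f) (hg : Measurable g) :
    Measurable fun a => f a *ᵥ g a :=
  measurable_pi_iff.2 fun i => by
    simp only [Matrix.mulVec, dotProduct]
    exact Finset.measurable_sum _ fun c _ =>
      (hf.matrix_entry i c).mul (measurable_pi_iff.1 hg c)

theorem Measurable.matrix_vecMulVec {α m n : Type*} [MeasurableSpace α]
    {f : α → m → ℝ} {g : α → n → ℝ} (hf : Measurable f) (hg : Measurable g) :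
    Measurable fun a => Matrix.vecMulVec (f a) (g a) :=
  measurable_matrix fun i j => (measurable_pi_iff.1 hf i).mul (measurable_pi_iff.1 hg j)

theorem Measurable.matrix_trace {α m : Type*} [MeasurableSpace α] [Fintype m]
    {f : α → Matrix m m ℝ} (hf : Measurable f) : Measurable fun a => (f a).trace :=
  Finset.measurable_sum _ fun i _ => hf.matrix_entry i i

theorem trace_transpose_mul_self {m n : Type*} [Fintype m] [Fintype n] (G : Matrix m n ℝ) :
    (Gᵀ * G).trace = ∑ i, ∑ j, G i j ^ 2 := by
  simp only [Matrix.trace, Matrix.diag, Matrix.mul_apply, Matrix.transpose_apply]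
  rw [Finset.sum_comm]
  simp only [sq]

theorem measurePreserving_gaussianRect_mul_left {m n : Type*} [Fintype m] [Fintype n]
    [DecidableEq m] (U : Matrix m m ℝ) (hU : Uᵀ * U = 1) :
    MeasurePreserving (fun G : m → n → ℝ => (U * Matrix.of G : Matrix m n ℝ))
      (gaussianRect m n) (gaussianRect m n) :=
  measurePreserving_gaussianRect
    (f := { toFun := fun G => U * Matrix.of G
            map_add' := fun x y => Matrix.mul_add U (Matrix.of x) (Matrix.of y)
            map_smul' := fun c x => Matrix.mul_smul U c (Matrix.of x) })
    fun G => by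
      have h1 := trace_transpose_mul_self (U * Matrix.of G)
      have h2 := trace_transpose_mul_self (Matrix.of G)
      rw [Matrix.transpose_mul, Matrix.mul_assoc, ← Matrix.mul_assoc Uᵀ, hU, Matrix.one_mul,
        h2] at h1
      exact h1.symm

theorem measurePreserving_gaussianRect_mul_right {m n : Type*} [Fintype m] [Fintype n]
    [DecidableEq n] (U : Matrix n n ℝ) (hU : U * Uᵀ = 1) :
    MeasurePreserving (fun G : m → n → ℝ => (Matrix.of G * U : Matrix m n ℝ))
      (gaussianRect m n) (gaussianRect m n) :=
  measurePreserving_gaussianRect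
    (f := { toFun := fun G => Matrix.of G * U
            map_add' := fun x y => Matrix.add_mul (Matrix.of x) (Matrix.of y) U
            map_smul' := fun c x => Matrix.smul_mul c (Matrix.of x) U })
    fun G => by
      have h1 := trace_transpose_mul_self (Matrix.of G * U)
      have h2 := trace_transpose_mul_self (Matrix.of G)
      rw [Matrix.trace_mul_comm, Matrix.transpose_mul, Matrix.mul_assoc, ← Matrix.mul_assoc U, hU,
        Matrix.one_mul, Matrix.trace_mul_comm, h2] at h1
      exact h1.symm

/-! ### Householder reflections -/

/-- The Euclidean length of a vector of real coordinates. -/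
noncomputable def euclLength {ι : Type*} [Fintype ι] (x : ι → ℝ) : ℝ := √(x ⬝ᵥ x)

/-- The vector `x - ‖x‖ e₀`, normal to the hyperplane of the Householder reflection that takes `x`
to `‖x‖ e₀`. -/
noncomputable def householderNormal {d : ℕ} (x : Fin (d + 1) → ℝ) : Fin (d + 1) → ℝ :=
  x - euclLength x • Pi.single 0 1

/-- The Householder reflection that takes `x` to `‖x‖ e₀`. If `x` is already a nonnegative multiple
of `e₀`, the normal vector is zero and, since `2 / 0 = 0`, this is the identity. -/
noncomputable def householder {d : ℕ} (x : Fin (d + 1) → ℝ) :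
    Matrix (Fin (d + 1)) (Fin (d + 1)) ℝ :=
  1 - (2 / (householderNormal x ⬝ᵥ householderNormal x)) •
    Matrix.vecMulVec (householderNormal x) (householderNormal x)

theorem euclLength_sq {ι : Type*} [Fintype ι] (x : ι → ℝ) : euclLength x ^ 2 = x ⬝ᵥ x :=
  Real.sq_sqrt (by simpa using dotProduct_star_self_nonneg x)

theorem householder_transpose {d : ℕ} (x : Fin (d + 1) → ℝ) :
    (householder x)ᵀ = householder x := by
  simp [householder, Matrix.transpose_vecMulVec]

theorem householder_mul_self {d : ℕ} (x : Fin (d + 1) → ℝ) :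
    householder x * householder x = 1 := by
  unfold householder
  set v := householderNormal x
  by_cases hv : v ⬝ᵥ v = 0
  · simp [hv]
  · simp only [Matrix.mul_sub, Matrix.sub_mul, Matrix.smul_mul, Matrix.mul_smul, Matrix.mul_one,
      Matrix.one_mul, Matrix.vecMulVec_mul_vecMulVec]
    ext i j
    simp [Matrix.vecMulVec_apply]
    field_simp
    ring

theorem householder_mulVec_self {d : ℕ} (x : Fin (d + 1) → ℝ) :
    householder x *ᵥ x = euclLength x • Pi.single 0 1 := by
  have hl := euclLength_sq x
  have hvv : householderNormal x ⬝ᵥ householderNormal x = 2 * (householderNormal x ⬝ᵥ x) := by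
    simp only [householderNormal, sub_dotProduct, dotProduct_sub, smul_dotProduct, dotProduct_smul,
      single_dotProduct, dotProduct_single, Pi.sub_apply, Pi.smul_apply, Pi.single_eq_same,
      smul_eq_mul]
    linear_combination hl
  unfold householder
  rw [Matrix.sub_mulVec, Matrix.one_mulVec, Matrix.smul_mulVec, Matrix.vecMulVec_mulVec]
  by_cases hv : householderNormal x ⬝ᵥ householderNormal x = 0
  · have h0 : householderNormal x = 0 := by simpa using hv
    rw [hv]
    simpa using sub_eq_zero.1 h0
  · have hvx : householderNormal x ⬝ᵥ x ≠ 0 := fun h => hv (by rw [hvv, h, mul_zero])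
    ext i
    have hi : householderNormal x i = x i - (euclLength x • (Pi.single 0 1 : Fin (d + 1) → ℝ)) i :=
      rfl
    rw [hvv]
    simp only [Pi.sub_apply, Pi.smul_apply, smul_eq_mul, MulOpposite.smul_eq_mul_unop,
      MulOpposite.unop_op] at hi ⊢
    field_simp
    linarith

theorem measurable_euclLength {ι : Type*} [Fintype ι] : Measurable (euclLength (ι := ι)) := by
  unfold euclLength dotProduct
  fun_prop

theorem measurable_householder {d : ℕ} : Measurable (householder (d := d)) := by
  have hv : Measurable (householderNormal (d := d)) := by
    refine measurable_pi_iff.2 fun i => ?_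
    simp only [householderNormal, Pi.sub_apply, Pi.smul_apply, smul_eq_mul]
    exact (measurable_pi_apply i).sub (measurable_euclLength.mul_const _)
  refine measurable_matrix fun i j => ?_
  simp only [householder, Matrix.sub_apply, Matrix.smul_apply, Matrix.vecMulVec_apply, smul_eq_mul,
    dotProduct]
  have h i : Measurable fun x : Fin (d + 1) → ℝ => householderNormal x i :=
    measurable_pi_iff.1 hv i
  have hs : Measurable fun x : Fin (d + 1) → ℝ =>
      ∑ i, householderNormal x i * householderNormal x i :=
    Finset.measurable_sum _ fun c _ => (h c).mul (h c)
  exact measurable_const.sub ((measurable_const.div hs).mul ((h i).mul (h j)))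

/-! ### One query to a Wishart matrix -/

instance {d : ℕ} : IsProbabilityMeasure (gaussianMatrix d) :=
  inferInstanceAs (IsProbabilityMeasure (gaussianRect (Fin d) (Fin d)))

theorem measurable_gram {m n : Type*} [Fintype m] :
    Measurable fun G : Matrix m n ℝ => Gᵀ * G :=
  measurable_id.matrix_transpose.matrix_mul measurable_id

instance {d : ℕ} : IsProbabilityMeasure (wishart d) :=
  Measure.isProbabilityMeasure_map measurable_gram.aemeasurable

/-- The isometric embedding of `ℝ^d` into `ℝ^(d+1)` as the coordinates other than the first. -/
def embedTail (d : ℕ) : Matrix (Fin (d + 1)) (Fin d) ℝ :=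
  Matrix.of fun i j => if i = j.succ then 1 else 0

/-- The first row `(‖g‖, r)` of the matrix obtained from a Gaussian matrix with first column `g`
by the reflection that takes `g` to `‖g‖ e₀`. -/
noncomputable def gramRow {d : ℕ} (u : (Fin (d + 1) → ℝ) × (Fin d → ℝ)) : Fin (d + 1) → ℝ :=
  Fin.cons (euclLength u.1) u.2

/-- The Wishart matrix assembled from the part `u` that a query to `x` reveals and an independent
Wishart matrix `W` of one dimension less, of which the query reveals nothing. -/
noncomputable def assemble {d : ℕ} (x : Fin (d + 1) → ℝ) (u : (Fin (d + 1) → ℝ) × (Fin d → ℝ))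
    (W : Matrix (Fin d) (Fin d) ℝ) : Matrix (Fin (d + 1)) (Fin (d + 1)) ℝ :=
  householder x * Matrix.vecMulVec (gramRow u) (gramRow u) * householder x +
    householder x * embedTail d * W * (householder x * embedTail d)ᵀ

theorem embedTail_transpose_mul (d : ℕ) : (embedTail d)ᵀ * embedTail d = 1 := by
  ext i j
  simp [Matrix.mul_apply, embedTail, Matrix.one_apply, Fin.succ_inj, eq_comm]

theorem embedTail_transpose_mulVec_single (d : ℕ) :
    (embedTail d)ᵀ *ᵥ (Pi.single 0 1) = 0 := by
  ext i
  simp [embedTail, (Fin.succ_ne_zero i).symm]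

theorem trace_assemble {d : ℕ} (x : Fin (d + 1) → ℝ) (u : (Fin (d + 1) → ℝ) × (Fin d → ℝ))
    (W : Matrix (Fin d) (Fin d) ℝ) :
    (assemble x u W).trace = (∑ i, u.1 i ^ 2 + ∑ i, u.2 i ^ 2) + W.trace := by
  have h := householder_mul_self x
  unfold assemble
  rw [Matrix.trace_add, Matrix.trace_mul_comm, ← Matrix.mul_assoc, h, Matrix.one_mul,
    Matrix.trace_mul_comm (householder x * embedTail d * W), Matrix.transpose_mul,
    householder_transpose, Matrix.mul_assoc, ← Matrix.mul_assoc (householder x),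
    ← Matrix.mul_assoc (householder x), h, Matrix.one_mul, ← Matrix.mul_assoc,
    embedTail_transpose_mul, Matrix.one_mul, Matrix.trace_vecMulVec]
  congr 1
  have hl := euclLength_sq u.1
  simp only [gramRow, dotProduct, Fin.sum_univ_succ, Fin.cons_zero, Fin.cons_succ] at hl ⊢
  rw [← sq, hl]
  simp only [sq]

/-- The response to the query `x` does not depend on the residual matrix `W`. -/
theorem assemble_mulVec {d : ℕ} (x : Fin (d + 1) → ℝ) (u : (Fin (d + 1) → ℝ) × (Fin d → ℝ))
    (W : Matrix (Fin d) (Fin d) ℝ) :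
    assemble x u W *ᵥ x = (euclLength x * euclLength u.1) • (householder x *ᵥ gramRow u) := by
  unfold assemble
  rw [Matrix.add_mulVec, Matrix.transpose_mul, householder_transpose,
    ← Matrix.mulVec_mulVec x _ (householder x), ← Matrix.mul_assoc,
    ← Matrix.mulVec_mulVec x _ (householder x), householder_mulVec_self,
    Matrix.mulVec_smul, Matrix.mulVec_smul, ← Matrix.mulVec_mulVec _ _ (embedTail d)ᵀ,
    embedTail_transpose_mulVec_single, Matrix.mulVec_zero, smul_zero, add_zero,
    ← Matrix.mulVec_mulVec, Matrix.vecMulVec_mulVec, mul_smul]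
  congr 1
  ext i
  simp [gramRow, Matrix.mulVec_smul]

theorem measurable_gramRow {d : ℕ} : Measurable (gramRow (d := d)) :=
  measurable_pi_iff.2 fun i => by
    refine Fin.cases ?_ (fun j => ?_) i
    · exact measurable_euclLength.comp measurable_fst
    · exact (measurable_pi_apply j).comp measurable_snd

theorem measurable_assemble {d : ℕ} :
    Measurable fun p : (Fin (d + 1) → ℝ) × ((Fin (d + 1) → ℝ) × (Fin d → ℝ)) ×
      Matrix (Fin d) (Fin d) ℝ => assemble p.1 p.2.1 p.2.2 := by
  have hH : Measurable fun p : (Fin (d + 1) → ℝ) × ((Fin (d + 1) → ℝ) × (Fin d → ℝ)) ×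
      Matrix (Fin d) (Fin d) ℝ => householder p.1 := measurable_householder.comp measurable_fst
  have hw : Measurable fun p : (Fin (d + 1) → ℝ) × ((Fin (d + 1) → ℝ) × (Fin d → ℝ)) ×
      Matrix (Fin d) (Fin d) ℝ => gramRow p.2.1 :=
    measurable_gramRow.comp (measurable_fst.comp measurable_snd)
  have hW : Measurable fun p : (Fin (d + 1) → ℝ) × ((Fin (d + 1) → ℝ) × (Fin d → ℝ)) ×
      Matrix (Fin d) (Fin d) ℝ => p.2.2 := measurable_snd.comp measurable_snd
  have hL := hH.matrix_mul (measurable_const (a := embedTail d))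
  exact ((hH.matrix_mul (hw.matrix_vecMulVec hw)).matrix_mul hH).matrix_add
    ((hL.matrix_mul hW).matrix_mul hL.matrix_transpose)

/-- Splitting off the first column. -/
theorem measurePreserving_splitColumn (m : Type*) [Fintype m] (d : ℕ) :
    MeasurePreserving
      (fun G : m → Fin (d + 1) → ℝ => ((fun i => G i 0, fun i j => G i j.succ) :
        (m → ℝ) × (m → Fin d → ℝ)))
      (gaussianRect m (Fin (d + 1))) ((gaussianVec m).prod (gaussianRect m (Fin d))) := by
  have h1 := measurePreserving_pi (fun _ : m => gaussianVec (Fin (d + 1)))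
    (fun _ : m => (gaussianReal 0 1).prod (gaussianVec (Fin d)))
    (fun _ => measurePreserving_piFinSuccAbove (fun _ : Fin (d + 1) => gaussianReal 0 1) 0)
  have h2 := measurePreserving_arrowProdEquivProdArrow ℝ (Fin d → ℝ) m
    (fun _ => gaussianReal 0 1) (fun _ => gaussianVec (Fin d))
  exact h2.comp h1

/-- Splitting off the first row. -/
theorem measurePreserving_splitRow (d n : ℕ) :
    MeasurePreserving
      (fun G : Fin (d + 1) → Fin n → ℝ => ((G 0, fun i => G i.succ) :
        (Fin n → ℝ) × (Fin d → Fin n → ℝ)))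
      (gaussianRect (Fin (d + 1)) (Fin n))
      ((gaussianVec (Fin n)).prod (gaussianRect (Fin d) (Fin n))) :=
  measurePreserving_piFinSuccAbove (fun _ : Fin (d + 1) => gaussianVec (Fin n)) 0

/-- Reflecting the remaining columns of a Gaussian matrix by the reflection that takes its first
column to a multiple of `e₀` preserves the law, because the columns are independent. -/
theorem measurePreserving_reflect (d n : ℕ) :
    MeasurePreserving
      (fun p : (Fin (d + 1) → ℝ) × (Fin (d + 1) → Fin n → ℝ) =>
        ((p.1, (householder p.1 * Matrix.of p.2 : Matrix (Fin (d + 1)) (Fin n) ℝ)) :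
          (Fin (d + 1) → ℝ) × (Fin (d + 1) → Fin n → ℝ)))
      ((gaussianVec (Fin (d + 1))).prod (gaussianRect (Fin (d + 1)) (Fin n)))
      ((gaussianVec (Fin (d + 1))).prod (gaussianRect (Fin (d + 1)) (Fin n))) := by
  refine MeasurePreserving.skew_product (f := id)
    (g := fun x R => (householder x * Matrix.of R : Matrix (Fin (d + 1)) (Fin n) ℝ))
    (MeasurePreserving.id _) ?_ (Filter.Eventually.of_forall fun x => ?_)
  · exact (measurable_householder.comp measurable_fst).matrix_mul
      (measurable_snd (α := Fin (d + 1) → ℝ) (β := Matrix (Fin (d + 1)) (Fin n) ℝ))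
  · exact (measurePreserving_gaussianRect_mul_left (householder x)
      (by rw [householder_transpose, householder_mul_self])).map_eq

/-- The Gram matrix of `G` in terms of its first column `g` and the remaining columns `R`, after the
reflection that takes `g` to `‖g‖ e₀`. -/
theorem gram_eq_of_reflect {d : ℕ} (G : Matrix (Fin (d + 1)) (Fin (d + 1)) ℝ)
    (g : Fin (d + 1) → ℝ) (hg : g = fun i => G i 0) (R R' : Matrix (Fin (d + 1)) (Fin d) ℝ)
    (hR : R = Matrix.of fun i j => G i j.succ) (hR' : R' = householder g * R) :
    Gᵀ * G = Matrix.vecMulVec (gramRow (g, R' 0)) (gramRow (g, R' 0)) +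
      embedTail d * ((Matrix.of fun i => R' i.succ)ᵀ * (Matrix.of fun i => R' i.succ)) *
        (embedTail d)ᵀ := by
  have h0 : ∀ i, (householder g * G) i 0 = (euclLength g • (Pi.single 0 1 : Fin (d + 1) → ℝ)) i := by
    intro i
    rw [← householder_mulVec_self, hg]
    rfl
  have hs : ∀ i j, (householder g * G) i (Fin.succ j) = R' i j := by
    intro i j
    rw [hR', hR]
    rfl
  have hG : Gᵀ * G = (householder g * G)ᵀ * (householder g * G) := by
    rw [Matrix.transpose_mul, householder_transpose, Matrix.mul_assoc,
      ← Matrix.mul_assoc (householder g), householder_mul_self, Matrix.one_mul]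
  have hJ : ∀ (A : Matrix (Fin d) (Fin d) ℝ) i j,
      (embedTail d * A * (embedTail d)ᵀ) (Fin.succ i) (Fin.succ j) = A i j := by
    intro A i j
    simp [Matrix.mul_apply, embedTail, Fin.succ_inj]
  have hJ0 : ∀ (A : Matrix (Fin d) (Fin d) ℝ) i,
      (embedTail d * A * (embedTail d)ᵀ) 0 i = 0 := by
    intro A i
    simp [Matrix.mul_apply, embedTail, (Fin.succ_ne_zero _).symm]
  have hJ1 : ∀ (A : Matrix (Fin d) (Fin d) ℝ) i,
      (embedTail d * A * (embedTail d)ᵀ) i 0 = 0 := by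
    intro A i
    simp [Matrix.mul_apply, embedTail, (Fin.succ_ne_zero _).symm]
  rw [hG]
  ext i j
  rw [Matrix.mul_apply, Fin.sum_univ_succ]
  simp only [Matrix.transpose_apply, Matrix.add_apply, Matrix.vecMulVec_apply]
  refine Fin.cases ?_ (fun i => ?_) i <;> refine Fin.cases ?_ (fun j => ?_) j
  · simp [h0, hJ0, gramRow]
  · simp [h0, hs, hJ0, gramRow]
  · simp [h0, hs, hJ1, gramRow]
  · simp [hs, hJ, gramRow, Matrix.mul_apply]

theorem measurePreserving_wishart_conj {d : ℕ} (U : Matrix (Fin d) (Fin d) ℝ) (hU : Uᵀ = U)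
    (hU2 : U * U = 1) :
    MeasurePreserving (fun W => U * W * U) (wishart d) (wishart d) := by
  have hm : Measurable fun W : Matrix (Fin d) (Fin d) ℝ => U * W * U :=
    (measurable_const.matrix_mul measurable_id).matrix_mul measurable_const
  have hr := measurePreserving_gaussianRect_mul_right (m := Fin d) U (by rw [hU, hU2])
  have hr' : MeasurePreserving (fun G : Matrix (Fin d) (Fin d) ℝ => G * U) (gaussianMatrix d)
    (gaussianMatrix d) := hr
  refine ⟨hm, ?_⟩
  unfold wishart
  rw [Measure.map_map hm measurable_gram]
  conv_rhs => rw [← hr'.map_eq, Measure.map_map measurable_gram hr'.measurable]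
  congr 1
  funext G
  simp [Matrix.transpose_mul, hU, Matrix.mul_assoc]

theorem measurePreserving_wishart_succ (d : ℕ) :
    MeasurePreserving
      (fun p : ((Fin (d + 1) → ℝ) × (Fin d → ℝ)) × Matrix (Fin d) (Fin d) ℝ =>
        Matrix.vecMulVec (gramRow p.1) (gramRow p.1) + embedTail d * p.2 * (embedTail d)ᵀ)
      (((gaussianVec (Fin (d + 1))).prod (gaussianVec (Fin d))).prod (wishart d))
      (wishart (d + 1)) := by
  have hΦ : Measurable
      (fun p : ((Fin (d + 1) → ℝ) × (Fin d → ℝ)) × Matrix (Fin d) (Fin d) ℝ =>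
        Matrix.vecMulVec (gramRow p.1) (gramRow p.1) + embedTail d * p.2 * (embedTail d)ᵀ) := by
    have hw : Measurable fun p : ((Fin (d + 1) → ℝ) × (Fin d → ℝ)) × Matrix (Fin d) (Fin d) ℝ =>
        gramRow p.1 := measurable_gramRow.comp measurable_fst
    exact (hw.matrix_vecMulVec hw).matrix_add
      ((measurable_const.matrix_mul measurable_snd).matrix_mul measurable_const)
  have hgram : MeasurePreserving (fun G : Fin d → Fin d → ℝ => (Matrix.of G)ᵀ * Matrix.of G)
      (gaussianRect (Fin d) (Fin d)) (wishart d) := ⟨measurable_gram, rfl⟩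
  have h3 := (MeasurePreserving.id (gaussianVec (Fin (d + 1)))).prod
    (((MeasurePreserving.id (gaussianVec (Fin d))).prod hgram).comp
      (measurePreserving_splitRow d d))
  have hassoc := (measurePreserving_prodAssoc (gaussianVec (Fin (d + 1))) (gaussianVec (Fin d))
    (wishart d)).symm
  have hall := hassoc.comp (h3.comp ((measurePreserving_reflect d d).comp
    (measurePreserving_splitColumn (Fin (d + 1)) d)))
  refine ⟨hΦ, ?_⟩
  rw [← hall.map_eq, Measure.map_map hΦ hall.measurable]
  unfold wishart
  refine congrArg (fun f => Measure.map f (gaussianMatrix (d + 1))) ?_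
  funext G
  exact (gram_eq_of_reflect G _ rfl _ _ rfl rfl).symm

theorem measurePreserving_assemble {d : ℕ} (x : Fin (d + 1) → ℝ) :
    MeasurePreserving
      (fun p : ((Fin (d + 1) → ℝ) × (Fin d → ℝ)) × Matrix (Fin d) (Fin d) ℝ => assemble x p.1 p.2)
      (((gaussianVec (Fin (d + 1))).prod (gaussianVec (Fin d))).prod (wishart d))
      (wishart (d + 1)) := by
  convert (measurePreserving_wishart_conj (householder x) (householder_transpose x)
    (householder_mul_self x)).comp (measurePreserving_wishart_succ d) using 1
  funext p
  simp only [assemble, Function.comp, Matrix.mul_add, Matrix.add_mul, Matrix.transpose_mul,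
    householder_transpose, Matrix.mul_assoc]

/-! ### Chi-squared moments of the trace -/

theorem integral_pow_four_gaussianReal : ∫ x, x ^ 4 ∂gaussianReal 0 1 = 3 := by
  rw [integral_gaussianReal_eq_integral_smul one_ne_zero]
  have h0 : ∀ x : ℝ, gaussianPDFReal 0 1 x • x ^ 4 =
      (√(2 * Real.pi))⁻¹ * (|x| ^ (4 : ℝ) * Real.exp (-(1 / 2) * |x| ^ (2 : ℝ))) := by
    intro x
    rw [gaussianPDFReal]
    have h4 : |x| ^ (4 : ℝ) = x ^ 4 := by
      rw [show (4 : ℝ) = ((4 : ℕ) : ℝ) by norm_num, Real.rpow_natCast]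
      exact (even_two_mul 2).pow_abs x
    have h2 : |x| ^ (2 : ℝ) = x ^ 2 := by
      rw [show (2 : ℝ) = ((2 : ℕ) : ℝ) by norm_num, Real.rpow_natCast, sq_abs]
    rw [h4, h2]
    simp only [NNReal.coe_one, mul_one, sub_zero, smul_eq_mul]
    rw [show -(1 / 2) * x ^ 2 = -x ^ 2 / 2 by ring]
    ring
  simp_rw [h0]
  rw [integral_const_mul,
    integral_comp_abs (f := fun x => x ^ (4 : ℝ) * Real.exp (-(1 / 2) * x ^ (2 : ℝ))),
    integral_rpow_mul_exp_neg_mul_rpow (by norm_num) (by norm_num) (by norm_num)]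
  have hG : Real.Gamma ((4 + 1) / 2) = 3 / 4 * √Real.pi := by
    rw [show ((4 : ℝ) + 1) / 2 = (1 / 2 + 1) + 1 by norm_num, Real.Gamma_add_one (by norm_num),
      Real.Gamma_add_one (by norm_num), Real.Gamma_one_half_eq]
    ring
  have hp : ((1 : ℝ) / 2) ^ (-(4 + 1) / 2 : ℝ) = 4 * √2 := by
    rw [one_div, Real.inv_rpow (by norm_num), ← Real.rpow_neg (by norm_num),
      show -(-((4 : ℝ) + 1) / 2) = (2 : ℕ) + 1 / 2 by norm_num, Real.rpow_add (by norm_num),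
      Real.rpow_natCast, Real.sqrt_eq_rpow]
    norm_num
  have hs2 : √(2 : ℝ) ≠ 0 := by positivity
  have hsp : √Real.pi ≠ 0 := by positivity
  rw [hG, hp, Real.sqrt_mul (by norm_num)]
  field_simp

/-- `X` is square integrable and has the mean and the variance of a chi-squared variable with `N`
degrees of freedom. -/
structure HasChiSqMoments {Ω : Type*} [MeasurableSpace Ω] (X : Ω → ℝ) (μ : Measure Ω) (N : ℝ) :
    Prop where
  memLp : MemLp X 2 μ
  mean : ∫ ω, X ω ∂μ = N
  variance : Var[X; μ] = 2 * N

theorem hasChiSqMoments_sq_gaussianReal :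
    HasChiSqMoments (fun x : ℝ => x ^ 2) (gaussianReal 0 1) 1 := by
  have h2 : MemLp (fun x : ℝ => x ^ 2) 2 (gaussianReal 0 1) := by
    have h := (memLp_id_gaussianReal' (μ := 0) (v := 1) 4 (by norm_num)).integrable_norm_pow
      (p := 4) (by norm_num)
    refine (memLp_two_iff_integrable_sq (by fun_prop)).2 ?_
    refine h.congr (Filter.Eventually.of_forall fun x => ?_)
    simp only [id, Real.norm_eq_abs]
    rw [show 4 = 2 * 2 from rfl, (even_two_mul 2).pow_abs, pow_mul]
  have hm : ∫ x, x ^ 2 ∂gaussianReal 0 1 = 1 := by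
    have h := variance_id_gaussianReal (μ := 0) (v := 1)
    rw [variance_eq_sub (memLp_id_gaussianReal' 2 (by norm_num))] at h
    simpa using h
  refine ⟨h2, hm, ?_⟩
  rw [variance_eq_sub h2, hm]
  have : ∫ x, ((fun x : ℝ => x ^ 2) ^ 2) x ∂gaussianReal 0 1 = 3 := by
    rw [← integral_pow_four_gaussianReal]
    refine integral_congr_ae (Filter.Eventually.of_forall fun x => ?_)
    simp only [Pi.pow_apply]
    ring
  rw [this]
  norm_num

theorem HasChiSqMoments.sum_pi {ι Ω : Type*} [Fintype ι] [MeasurableSpace Ω] {X : Ω → ℝ}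
    {μ : Measure Ω} [IsProbabilityMeasure μ] {N : ℝ} (h : HasChiSqMoments X μ N) :
    HasChiSqMoments (fun ω : ι → Ω => ∑ i, X (ω i)) (Measure.pi fun _ => μ)
      (Fintype.card ι * N) := by
  have hi : ∀ i : ι, MemLp (fun ω : ι → Ω => X (ω i)) 2 (Measure.pi fun _ => μ) := fun i =>
    h.memLp.comp_measurePreserving (measurePreserving_eval (fun _ : ι => μ) i)
  refine ⟨memLp_finsetSum _ fun i _ => hi i, ?_, ?_⟩
  · rw [integral_finsetSum _ fun i _ => (hi i).integrable one_le_two]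
    have : ∀ i : ι, ∫ ω : ι → Ω, X (ω i) ∂(Measure.pi fun _ => μ) = N := fun i => by
      rw [← h.mean]
      exact integral_comp_eval (μ := fun _ : ι => μ) h.memLp.1
    simp [this]
  · have := variance_sum_pi (μ := fun _ : ι => μ) (X := fun _ => X) fun _ => h.memLp
    rw [show (fun ω : ι → Ω => ∑ i, X (ω i)) = ∑ i, fun ω : ι → Ω => X (ω i) by
      ext ω; simp, this]
    simp [h.variance]
    ring

theorem HasChiSqMoments.add_prod {Ω Ω' : Type*} [MeasurableSpace Ω] [MeasurableSpace Ω']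
    {X : Ω → ℝ} {Y : Ω' → ℝ} {μ : Measure Ω} {ν : Measure Ω'} [IsProbabilityMeasure μ]
    [IsProbabilityMeasure ν] {N M : ℝ} (hX : HasChiSqMoments X μ N)
    (hY : HasChiSqMoments Y ν M) :
    HasChiSqMoments (fun p : Ω × Ω' => X p.1 + Y p.2) (μ.prod ν) (N + M) := by
  have h1 : MemLp (fun p : Ω × Ω' => X p.1) 2 (μ.prod ν) :=
    hX.memLp.comp_measurePreserving measurePreserving_fst
  have h2 : MemLp (fun p : Ω × Ω' => Y p.2) 2 (μ.prod ν) :=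
    hY.memLp.comp_measurePreserving measurePreserving_snd
  refine ⟨h1.add h2, ?_, ?_⟩
  · rw [integral_add (h1.integrable one_le_two) (h2.integrable one_le_two)]
    simp [integral_fun_fst, integral_fun_snd, hX.mean, hY.mean]
  · rw [variance_add_prod hX.memLp hY.memLp, hX.variance, hY.variance]
    ring

/-- The second moment of a shifted variable. -/
theorem HasChiSqMoments.integral_add_sq {Ω : Type*} [MeasurableSpace Ω] {X : Ω → ℝ}
    {μ : Measure Ω} [IsProbabilityMeasure μ] {N : ℝ} (h : HasChiSqMoments X μ N) (b : ℝ) :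
    Integrable (fun ω => (b + X ω) ^ 2) μ ∧ ∫ ω, (b + X ω) ^ 2 ∂μ = (b + N) ^ 2 + 2 * N := by
  have hb : MemLp (fun ω => b + X ω) 2 μ := (memLp_const b).add h.memLp
  refine ⟨hb.integrable_sq, ?_⟩
  have hv := variance_eq_sub hb
  rw [variance_const_add h.memLp.1, h.variance,
    integral_add (integrable_const b) (h.memLp.integrable one_le_two), h.mean] at hv
  simp only [integral_const, probReal_univ, smul_eq_mul, one_mul, Pi.pow_apply] at hv
  linarith

theorem hasChiSqMoments_gaussianVec (ι : Type*) [Fintype ι] :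
    HasChiSqMoments (fun x : ι → ℝ => ∑ i, x i ^ 2) (gaussianVec ι) (Fintype.card ι) := by
  simpa using hasChiSqMoments_sq_gaussianReal.sum_pi (ι := ι)

theorem hasChiSqMoments_trace_wishart (d : ℕ) :
    HasChiSqMoments Matrix.trace (wishart d) ((d : ℝ) ^ 2) := by
  have h := (hasChiSqMoments_gaussianVec (Fin d)).sum_pi (ι := Fin d)
  have hmp : MeasurePreserving (fun G : Fin d → Fin d → ℝ => (Matrix.of G)ᵀ * Matrix.of G)
      (gaussianRect (Fin d) (Fin d)) (wishart d) := ⟨measurable_gram, rfl⟩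
  have ht : Measurable (Matrix.trace : Matrix (Fin d) (Fin d) ℝ → ℝ) :=
    measurable_id.matrix_trace
  have he : (fun G : Fin d → Fin d → ℝ => ∑ i, ∑ j, G i j ^ 2) =
      Matrix.trace ∘ (fun G : Fin d → Fin d → ℝ => (Matrix.of G)ᵀ * Matrix.of G) :=
    funext fun G => (trace_transpose_mul_self (Matrix.of G)).symm
  rw [he, Fintype.card_fin, ← sq] at h
  refine ⟨?_, ?_, ?_⟩
  · exact (memLp_map_measure_iff ht.aestronglyMeasurable hmp.measurable.aemeasurable).2 h.memLp |>
      fun h' => by rwa [hmp.map_eq] at h'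
  · rw [← hmp.map_eq, integral_map hmp.measurable.aemeasurable ht.aestronglyMeasurable]
    exact h.mean
  · rw [← hmp.map_eq, variance_map ht.aemeasurable hmp.measurable.aemeasurable]
    exact h.variance

/-! ### Adaptive estimators with separate access to the factors -/

universe u v

/-- `f s W` is the output of an adaptive estimator with seed `s` that makes `q` queries, each of
which asks for one matrix-vector product with every one of the matrices `W₁, …, W_k`. After a query,
the responses are joined to the seed, so the estimator that remains has one query less and a larger
seed. -/
def IsAdaptiveEstimator {k d : ℕ} : ℕ → ∀ {S : Type u} [MeasurableSpace S],
    (S → (Fin k → Matrix (Fin d) (Fin d) ℝ) → ℝ) → Prop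
  | 0, S, _, f => ∃ g : S → ℝ, Measurable g ∧ ∀ s W, f s W = g s
  | q + 1, S, _, f => ∃ x : S → Fin k → Fin d → ℝ, Measurable x ∧
      ∃ f' : S × (Fin k → Fin d → ℝ) → (Fin k → Matrix (Fin d) (Fin d) ℝ) → ℝ,
        IsAdaptiveEstimator q f' ∧ ∀ s W, f s W = f' (s, fun i => W i *ᵥ x s i) W

theorem measurable_pi_mulVec {α : Type*} [MeasurableSpace α] {k : ℕ} {m n : Type*} [Fintype n]
    {A : α → Fin k → Matrix m n ℝ} {x : α → Fin k → n → ℝ} (hA : Measurable A)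
    (hx : Measurable x) : Measurable fun a i => A a i *ᵥ x a i :=
  measurable_pi_iff.2 fun i =>
    (measurable_pi_iff.1 hA i).matrix_mulVec (measurable_pi_iff.1 hx i)

theorem IsAdaptiveEstimator.measurable {k d q : ℕ} {S : Type u} [MeasurableSpace S]
    {f : S → (Fin k → Matrix (Fin d) (Fin d) ℝ) → ℝ} (hf : IsAdaptiveEstimator q f) :
    Measurable (Function.uncurry f) := by
  induction q generalizing S with
  | zero =>
    obtain ⟨g, hg, h⟩ := hf
    exact (funext fun p => h p.1 p.2 : Function.uncurry f = fun p => g p.1) ▸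
      hg.comp measurable_fst
  | succ q ih =>
    obtain ⟨x, hx, f', hf', h⟩ := hf
    have he : Function.uncurry f = fun p => Function.uncurry f'
        ((p.1, fun i => p.2 i *ᵥ x p.1 i), p.2) := funext fun p => h p.1 p.2
    rw [he]
    exact (ih hf').comp ((measurable_fst.prodMk
      (measurable_pi_mulVec measurable_snd (hx.comp measurable_fst))).prodMk measurable_snd)

/-- An estimator for the matrices `Bᵢ + Lᵢ Wᵢ Lᵢᵀ`, where `Bᵢ` and `Lᵢ` depend on the seed only, is
also an estimator for the matrices `Wᵢ`: a query `x` to the former needs only the query `Lᵢᵀ x` to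
the latter. -/
theorem IsAdaptiveEstimator.comp_congruence {k d d' q : ℕ} {S : Type u} {S' : Type v}
    [MeasurableSpace S] [MeasurableSpace S']
    {f : S → (Fin k → Matrix (Fin d) (Fin d) ℝ) → ℝ} (hf : IsAdaptiveEstimator q f)
    {φ : S' → S} (hφ : Measurable φ) {B : S' → Fin k → Matrix (Fin d) (Fin d) ℝ}
    (hB : Measurable B) {L : S' → Fin k → Matrix (Fin d) (Fin d') ℝ} (hL : Measurable L) :
    IsAdaptiveEstimator q fun s (W : Fin k → Matrix (Fin d') (Fin d') ℝ) =>
      f (φ s) fun i => B s i + L s i * W i * (L s i)ᵀ := by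
  induction q generalizing S S' with
  | zero =>
    obtain ⟨g, hg, h⟩ := hf
    exact ⟨g ∘ φ, hg.comp hφ, fun s W => h _ _⟩
  | succ q ih =>
    obtain ⟨x, hx, f', hf', h⟩ := hf
    have hxφ := hx.comp hφ
    have hLt : Measurable fun (s : S') (i : Fin k) => (L s i)ᵀ :=
      measurable_pi_iff.2 fun i => (measurable_pi_iff.1 hL i).matrix_transpose
    have hy : Measurable fun p : S' × (Fin k → Fin d' → ℝ) =>
        (φ p.1, fun i => B p.1 i *ᵥ x (φ p.1) i + L p.1 i *ᵥ p.2 i) :=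
      (hφ.comp measurable_fst).prodMk
        ((measurable_pi_mulVec (hB.comp measurable_fst) (hxφ.comp measurable_fst)).add
          (measurable_pi_mulVec (hL.comp measurable_fst) measurable_snd))
    refine ⟨fun s i => (L s i)ᵀ *ᵥ x (φ s) i, measurable_pi_mulVec hLt hxφ, _,
      ih hf' hy (hB.comp measurable_fst) (hL.comp measurable_fst), fun s W => (h _ _).trans ?_⟩
    simp only [Matrix.add_mulVec, Matrix.mulVec_mulVec, Matrix.mul_assoc, Function.comp]

/-- The revealed part of a query: a Gaussian vector of the current dimension and one of a dimension
less, independent. -/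
noncomputable abbrev revealLaw (d : ℕ) : Measure ((Fin (d + 1) → ℝ) × (Fin d → ℝ)) :=
  (gaussianVec (Fin (d + 1))).prod (gaussianVec (Fin d))

theorem measurePreserving_assemble_pi {k d : ℕ} (x : Fin k → Fin (d + 1) → ℝ) :
    MeasurePreserving
      (fun p : (Fin k → (Fin (d + 1) → ℝ) × (Fin d → ℝ)) × (Fin k → Matrix (Fin d) (Fin d) ℝ) =>
        fun i => assemble (x i) (p.1 i) (p.2 i))
      ((Measure.pi fun _ => revealLaw d).prod (Measure.pi fun _ => wishart d))
      (Measure.pi fun _ => wishart (d + 1)) := by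
  have h1 : MeasurePreserving
      (fun (p : Fin k → ((Fin (d + 1) → ℝ) × (Fin d → ℝ)) × Matrix (Fin d) (Fin d) ℝ) i =>
        assemble (x i) (p i).1 (p i).2)
      (Measure.pi fun _ => (revealLaw d).prod (wishart d)) (Measure.pi fun _ => wishart (d + 1)) :=
    measurePreserving_pi (fun _ : Fin k => (revealLaw d).prod (wishart d))
      (fun _ : Fin k => wishart (d + 1)) fun i => measurePreserving_assemble (x i)
  have h2 : MeasurePreserving
      (fun (p : (Fin k → (Fin (d + 1) → ℝ) × (Fin d → ℝ)) × (Fin k → Matrix (Fin d) (Fin d) ℝ)) i =>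
        (p.1 i, p.2 i))
      ((Measure.pi fun _ => revealLaw d).prod (Measure.pi fun _ => wishart d))
      (Measure.pi fun _ => (revealLaw d).prod (wishart d)) :=
    (measurePreserving_arrowProdEquivProdArrow ((Fin (d + 1) → ℝ) × (Fin d → ℝ))
      (Matrix (Fin d) (Fin d) ℝ) (Fin k) (fun _ => revealLaw d) (fun _ => wishart d)).symm
  have h3 := h1.comp h2
  exact h3

theorem measurable_pi_assemble {S : Type*} [MeasurableSpace S] {k d : ℕ}
    {x : S → Fin k → Fin (d + 1) → ℝ} (hx : Measurable x) :
    Measurable fun p : (S × (Fin k → (Fin (d + 1) → ℝ) × (Fin d → ℝ))) ×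
      (Fin k → Matrix (Fin d) (Fin d) ℝ) => fun i => assemble (x p.1.1 i) (p.1.2 i) (p.2 i) := by
  refine measurable_pi_iff.2 fun i => ?_
  have h1 : Measurable fun p : (S × (Fin k → (Fin (d + 1) → ℝ) × (Fin d → ℝ))) ×
      (Fin k → Matrix (Fin d) (Fin d) ℝ) => x p.1.1 i :=
    (measurable_pi_iff.1 hx i).comp (measurable_fst.comp measurable_fst)
  have h2 : Measurable fun p : (S × (Fin k → (Fin (d + 1) → ℝ) × (Fin d → ℝ))) ×
      (Fin k → Matrix (Fin d) (Fin d) ℝ) => p.1.2 i :=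
    (measurable_pi_apply i).comp (measurable_snd.comp measurable_fst)
  have h3 : Measurable fun p : (S × (Fin k → (Fin (d + 1) → ℝ) × (Fin d → ℝ))) ×
      (Fin k → Matrix (Fin d) (Fin d) ℝ) => p.2 i :=
    (measurable_pi_apply i).comp measurable_snd
  have h4 := measurable_assemble.comp (h1.prodMk (h2.prodMk h3))
  exact h4

/-- Integrals over a random seed and Wishart matrices independent of it, decomposed along the
queries `x s`. -/
theorem lintegral_wishart_succ {S : Type*} [MeasurableSpace S] (P : Measure S) [SFinite P]
    {k d : ℕ} {x : S → Fin k → Fin (d + 1) → ℝ} (hx : Measurable x)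
    {F : S → (Fin k → Matrix (Fin (d + 1)) (Fin (d + 1)) ℝ) → ENNReal}
    (hF : Measurable (Function.uncurry F)) :
    ∫⁻ s, ∫⁻ W, F s W ∂(Measure.pi fun _ => wishart (d + 1)) ∂P =
      ∫⁻ p, ∫⁻ W, F p.1 (fun i => assemble (x p.1 i) (p.2 i) (W i))
        ∂(Measure.pi fun _ => wishart d) ∂(P.prod (Measure.pi fun _ => revealLaw d)) := by
  have hm : Measurable fun p : (S × (Fin k → (Fin (d + 1) → ℝ) × (Fin d → ℝ))) ×
      (Fin k → Matrix (Fin d) (Fin d) ℝ) =>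
      F p.1.1 (fun i => assemble (x p.1.1 i) (p.1.2 i) (p.2 i)) :=
    hF.comp ((measurable_fst.comp measurable_fst).prodMk (measurable_pi_assemble hx))
  rw [lintegral_prod _ (Measurable.lintegral_prod_right hm).aemeasurable]
  refine lintegral_congr fun s => ?_
  have hs : Measurable (F s) := hF.comp measurable_prodMk_left
  rw [← (measurePreserving_assemble_pi (x s)).lintegral_comp hs, lintegral_prod]
  exact (hs.comp (measurePreserving_assemble_pi (x s)).measurable).aemeasurable

/-! ### The error of an adaptive estimator -/

/-- The second moment of `b + tr W`, for `W` a Wishart matrix of dimension `d`. -/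
def shiftedSecondMoment (d b : ℝ) : ℝ := (b + d ^ 2) ^ 2 + 2 * d ^ 2

/-- The revealed part of the trace has `2 d + 1` degrees of freedom, and averaging over it turns the
shifted second moment for dimension `d` into that for dimension `d + 1`. The two products in
`errorBound` are the cases `c = 0` and `c = 2 n²`. -/
theorem integral_prod_shiftedSecondMoment {k d : ℕ} (b : Fin k → ℝ) (c : ℝ) :
    Integrable (fun u : Fin k → (Fin (d + 1) → ℝ) × (Fin d → ℝ) =>
      ∏ i, (shiftedSecondMoment d (b i + (∑ j, (u i).1 j ^ 2 + ∑ j, (u i).2 j ^ 2)) - c))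
      (Measure.pi fun _ => revealLaw d) ∧
    ∫ u : Fin k → (Fin (d + 1) → ℝ) × (Fin d → ℝ),
      ∏ i, (shiftedSecondMoment d (b i + (∑ j, (u i).1 j ^ 2 + ∑ j, (u i).2 j ^ 2)) - c)
      ∂(Measure.pi fun _ => revealLaw d) =
    ∏ i, (shiftedSecondMoment (d + 1) (b i) - c) := by
  have h := (hasChiSqMoments_gaussianVec (Fin (d + 1))).add_prod
    (hasChiSqMoments_gaussianVec (Fin d))
  have hi : ∀ b : ℝ, Integrable (fun u : (Fin (d + 1) → ℝ) × (Fin d → ℝ) =>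
      shiftedSecondMoment d (b + (∑ j, u.1 j ^ 2 + ∑ j, u.2 j ^ 2)) - c) (revealLaw d) ∧
      ∫ u : (Fin (d + 1) → ℝ) × (Fin d → ℝ),
        (shiftedSecondMoment d (b + (∑ j, u.1 j ^ 2 + ∑ j, u.2 j ^ 2)) - c) ∂(revealLaw d) =
      shiftedSecondMoment (d + 1) b - c := by
    intro b
    obtain ⟨h1, h2⟩ := h.integral_add_sq (b + (d : ℝ) ^ 2)
    have he : ∀ u : (Fin (d + 1) → ℝ) × (Fin d → ℝ),
        shiftedSecondMoment d (b + (∑ j, u.1 j ^ 2 + ∑ j, u.2 j ^ 2)) - c =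
        (b + (d : ℝ) ^ 2 + (∑ j, u.1 j ^ 2 + ∑ j, u.2 j ^ 2)) ^ 2 + (2 * (d : ℝ) ^ 2 - c) := by
      intro u
      simp only [shiftedSecondMoment]
      ring
    simp_rw [he]
    refine ⟨h1.add (integrable_const _), ?_⟩
    rw [integral_add h1 (integrable_const _), h2]
    simp only [integral_const, probReal_univ, smul_eq_mul, one_mul, Fintype.card_fin,
      shiftedSecondMoment]
    push_cast
    ring
  refine ⟨Integrable.fintype_prod_dep fun i => (hi (b i)).1, ?_⟩
  rw [integral_fintype_prod_eq_prod (fun i (u : (Fin (d + 1) → ℝ) × (Fin d → ℝ)) =>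
    shiftedSecondMoment d (b i + (∑ j, u.1 j ^ 2 + ∑ j, u.2 j ^ 2)) - c)]
  exact Finset.prod_congr rfl fun i _ => (hi (b i)).2

/-- The lower bound on the mean squared error: the second moment of the product of the traces,
minus the second moment of its conditional expectation given all that the queries reveal. -/
def errorBound {k : ℕ} (n d : ℝ) (b : Fin k → ℝ) : ℝ :=
  ∏ i, shiftedSecondMoment d (b i) - ∏ i, (shiftedSecondMoment d (b i) - 2 * n ^ 2)

theorem errorBound_nonneg {k : ℕ} {n d : ℝ} (hn : 0 ≤ n) (hnd : n ≤ d) (b : Fin k → ℝ) :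
    0 ≤ errorBound n d b := by
  refine sub_nonneg.2 (Finset.prod_le_prod (fun i _ => ?_) fun i _ => ?_)
  · unfold shiftedSecondMoment
    nlinarith [sq_nonneg (b i + d ^ 2), pow_le_pow_left₀ hn hnd 2]
  · nlinarith [sq_nonneg n]

theorem lintegral_errorBound {k n d : ℕ} (hnd : n ≤ d) (b : Fin k → ℝ) :
    ∫⁻ u : Fin k → (Fin (d + 1) → ℝ) × (Fin d → ℝ), ENNReal.ofReal
      (errorBound n d fun i => b i + (∑ j, (u i).1 j ^ 2 + ∑ j, (u i).2 j ^ 2))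
      ∂(Measure.pi fun _ => revealLaw d) = ENNReal.ofReal (errorBound n (d + 1) b) := by
  obtain ⟨h1, h2⟩ := integral_prod_shiftedSecondMoment (d := d) b 0
  obtain ⟨h3, h4⟩ := integral_prod_shiftedSecondMoment (d := d) b (2 * (n : ℝ) ^ 2)
  simp only [sub_zero] at h1 h2
  have h := ofReal_integral_eq_lintegral_ofReal (h1.sub h3)
    (Filter.Eventually.of_forall fun u => errorBound_nonneg (by positivity) (by exact_mod_cast hnd)
      _)
  rw [integral_sub' h1 h3, h2, h4] at h
  exact h.symm

theorem integral_prod_trace_sq {k n : ℕ} (b : Fin k → ℝ) :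
    Integrable (fun W : Fin k → Matrix (Fin n) (Fin n) ℝ => (∏ i, (b i + (W i).trace)) ^ 2)
      (Measure.pi fun _ => wishart n) ∧
    ∫ W : Fin k → Matrix (Fin n) (Fin n) ℝ, (∏ i, (b i + (W i).trace)) ^ 2
      ∂(Measure.pi fun _ => wishart n) = ∏ i, shiftedSecondMoment n (b i) := by
  have h := hasChiSqMoments_trace_wishart n
  have hsq : (fun W : Fin k → Matrix (Fin n) (Fin n) ℝ => (∏ i, (b i + (W i).trace)) ^ 2) =
      fun W => ∏ i, (b i + (W i).trace) ^ 2 :=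
    funext fun W => (Finset.prod_pow _ _ _).symm
  rw [hsq]
  refine ⟨Integrable.fintype_prod_dep
    (f := fun i (W : Matrix (Fin n) (Fin n) ℝ) => (b i + W.trace) ^ 2)
      fun i => (h.integral_add_sq (b i)).1, ?_⟩
  rw [integral_fintype_prod_eq_prod
    (fun i (W : Matrix (Fin n) (Fin n) ℝ) => (b i + W.trace) ^ 2)]
  exact Finset.prod_congr rfl fun i _ => (h.integral_add_sq (b i)).2

/-- Without queries, the error is at least the variance of the product of the traces. -/
theorem errorBound_le_lintegral_wishart {k n : ℕ} (b : Fin k → ℝ) (t : ℝ) :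
    ENNReal.ofReal (errorBound n n b) ≤ ∫⁻ W : Fin k → Matrix (Fin n) (Fin n) ℝ,
      ENNReal.ofReal ((t - ∏ i, (b i + (W i).trace)) ^ 2) ∂(Measure.pi fun _ => wishart n) := by
  have h := hasChiSqMoments_trace_wishart n
  set T : (Fin k → Matrix (Fin n) (Fin n) ℝ) → ℝ := fun W => ∏ i, (b i + (W i).trace) with hT
  have hi1 : Integrable T (Measure.pi fun _ => wishart n) :=
    Integrable.fintype_prod_dep (f := fun i (W : Matrix (Fin n) (Fin n) ℝ) => b i + W.trace)
      fun i => (integrable_const _).add (h.memLp.integrable one_le_two)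
  have hm1 : ∫ W, T W ∂(Measure.pi fun _ => wishart n) = ∏ i, (b i + (n : ℝ) ^ 2) := by
    rw [hT, integral_fintype_prod_eq_prod (fun i (W : Matrix (Fin n) (Fin n) ℝ) => b i + W.trace)]
    refine Finset.prod_congr rfl fun i _ => ?_
    rw [integral_add (integrable_const _) (h.memLp.integrable one_le_two), h.mean]
    simp
  obtain ⟨hi2, hm2⟩ := integral_prod_trace_sq (n := n) b
  have he : ∀ W, (t - T W) ^ 2 = t ^ 2 - 2 * t * T W + T W ^ 2 := fun W => by ring
  have hi : Integrable (fun W => t ^ 2 - 2 * t * T W) (Measure.pi fun _ => wishart n) :=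
    (integrable_const _).sub (hi1.const_mul _)
  have hint : Integrable (fun W => (t - T W) ^ 2) (Measure.pi fun _ => wishart n) := by
    simp_rw [he]
    exact hi.add hi2
  rw [← ofReal_integral_eq_lintegral_ofReal hint
    (Filter.Eventually.of_forall fun W => sq_nonneg _)]
  refine ENNReal.ofReal_le_ofReal ?_
  simp_rw [he]
  rw [integral_add hi hi2, integral_sub (integrable_const _) (hi1.const_mul _),
    integral_const_mul, hm1, hm2]
  have hv : ∏ i, (shiftedSecondMoment n (b i) - 2 * (n : ℝ) ^ 2) =
      (∏ i, (b i + (n : ℝ) ^ 2)) ^ 2 := by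
    rw [← Finset.prod_pow]
    exact Finset.prod_congr rfl fun i _ => by simp [shiftedSecondMoment]
  rw [errorBound, hv]
  simp only [integral_const, probReal_univ, smul_eq_mul, one_mul]
  nlinarith [sq_nonneg (t - ∏ i, (b i + (n : ℝ) ^ 2))]

/-- The mean squared error of an estimator with `q` queries for the product of the traces of
independent Wishart matrices of dimension `n + q`, shifted by known amounts `b`. Each query leaves
an independent Wishart matrix of one dimension less and adds the revealed part of the trace to the
known amount, so that after `q` queries the variance of Wishart matrices of dimension `n`
remains. -/
theorem IsAdaptiveEstimator.errorBound_le {k n q d : ℕ} (hd : d = n + q) {S : Type u} [MeasurableSpace S]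
    (P : Measure S) [SFinite P] {f : S → (Fin k → Matrix (Fin d) (Fin d) ℝ) → ℝ}
    (hf : IsAdaptiveEstimator q f) {b : S → Fin k → ℝ} (hb : Measurable b) :
    ∫⁻ s, ENNReal.ofReal (errorBound n d (b s)) ∂P ≤
      ∫⁻ s, ∫⁻ W, ENNReal.ofReal ((f s W - ∏ i, (b s i + (W i).trace)) ^ 2)
        ∂(Measure.pi fun _ => wishart d) ∂P := by
  induction q generalizing S d with
  | zero =>
    obtain ⟨g, hg, h⟩ := hf
    obtain rfl : d = n := hd
    simp_rw [h]
    exact lintegral_mono fun s => errorBound_le_lintegral_wishart (b s) (g s)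
  | succ q ih =>
    obtain rfl : d = n + q + 1 := hd
    have hfm := hf.measurable
    obtain ⟨x, hx, f', hf', h⟩ := hf
    have hbm : Measurable fun p : S × (Fin k → Matrix (Fin (n + q + 1)) (Fin (n + q + 1)) ℝ) =>
        ∏ i, (b p.1 i + (p.2 i).trace) :=
      Finset.measurable_prod _ fun i _ => ((measurable_pi_iff.1 hb i).comp measurable_fst).add
        ((measurable_pi_apply i).comp measurable_snd).matrix_trace
    have hF : Measurable (Function.uncurry fun s W =>
        ENNReal.ofReal ((f s W - ∏ i, (b s i + (W i).trace)) ^ 2)) :=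
      ((hfm.sub hbm).pow_const 2).ennreal_ofReal
    rw [lintegral_wishart_succ P hx hF]
    -- The response to the query is a function of the enlarged seed.
    let φ : S × (Fin k → (Fin (n + q + 1) → ℝ) × (Fin (n + q) → ℝ)) →
        S × (Fin k → Fin (n + q + 1) → ℝ) := fun p =>
      (p.1, fun i => (euclLength (x p.1 i) * euclLength (p.2 i).1) •
        (householder (x p.1 i) *ᵥ gramRow (p.2 i)))
    have hxi : ∀ i, Measurable fun p : S × (Fin k → (Fin (n + q + 1) → ℝ) × (Fin (n + q) → ℝ)) =>
        x p.1 i := fun i => (measurable_pi_iff.1 hx i).comp measurable_fst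
    have hui : ∀ i, Measurable fun p : S × (Fin k → (Fin (n + q + 1) → ℝ) × (Fin (n + q) → ℝ)) =>
        p.2 i := fun i => (measurable_pi_apply i).comp measurable_snd
    have hφ : Measurable φ := by
      refine measurable_fst.prodMk (measurable_pi_iff.2 fun i => ?_)
      exact ((measurable_euclLength.comp (hxi i)).mul
        (measurable_euclLength.comp (hui i).fst)).smul
        ((measurable_householder.comp (hxi i)).matrix_mulVec (measurable_gramRow.comp (hui i)))
    have hB : Measurable fun (p : S × (Fin k → (Fin (n + q + 1) → ℝ) × (Fin (n + q) → ℝ))) i =>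
        householder (x p.1 i) * Matrix.vecMulVec (gramRow (p.2 i)) (gramRow (p.2 i)) *
          householder (x p.1 i) :=
      measurable_pi_iff.2 fun i => ((measurable_householder.comp (hxi i)).matrix_mul
        ((measurable_gramRow.comp (hui i)).matrix_vecMulVec
          (measurable_gramRow.comp (hui i)))).matrix_mul (measurable_householder.comp (hxi i))
    have hL : Measurable fun (p : S × (Fin k → (Fin (n + q + 1) → ℝ) × (Fin (n + q) → ℝ))) i =>
        householder (x p.1 i) * embedTail (n + q) :=
      measurable_pi_iff.2 fun i =>
        (measurable_householder.comp (hxi i)).matrix_mul measurable_const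
    have hb' : Measurable fun (p : S × (Fin k → (Fin (n + q + 1) → ℝ) × (Fin (n + q) → ℝ))) i =>
        b p.1 i + (∑ j, (p.2 i).1 j ^ 2 + ∑ j, (p.2 i).2 j ^ 2) :=
      measurable_pi_iff.2 fun i => ((measurable_pi_iff.1 hb i).comp measurable_fst).add
        ((Finset.measurable_sum _ fun j _ =>
          ((measurable_pi_iff.1 (hui i).fst j).pow_const 2)).add
        (Finset.measurable_sum _ fun j _ =>
          ((measurable_pi_iff.1 (hui i).snd j).pow_const 2)))
    have key := ih rfl (P.prod (Measure.pi fun _ => revealLaw (n + q)))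
      (hf'.comp_congruence hφ hB hL) hb'
    have hEm : Measurable fun p : S × (Fin k → (Fin (n + q + 1) → ℝ) × (Fin (n + q) → ℝ)) =>
        ENNReal.ofReal (errorBound n ((n + q : ℕ) : ℝ) fun i =>
          b p.1 i + (∑ j, (p.2 i).1 j ^ 2 + ∑ j, (p.2 i).2 j ^ 2)) := by
      have hs : ∀ c : ℝ, Measurable fun p : S × (Fin k → (Fin (n + q + 1) → ℝ) ×
          (Fin (n + q) → ℝ)) => ∏ i, (shiftedSecondMoment ((n + q : ℕ) : ℝ)
            (b p.1 i + (∑ j, (p.2 i).1 j ^ 2 + ∑ j, (p.2 i).2 j ^ 2)) - c) := fun c =>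
        Finset.measurable_prod _ fun i _ =>
          ((((measurable_pi_iff.1 hb' i).add_const _).pow_const 2).add_const _).sub_const c
      have h0 := hs 0
      simp only [sub_zero] at h0
      exact (h0.sub (hs (2 * (n : ℝ) ^ 2))).ennreal_ofReal
    rw [lintegral_prod _ hEm.aemeasurable] at key
    simp_rw [lintegral_errorBound (Nat.le_add_right n q)] at key
    convert key using 2
    · push_cast
      rfl
    · funext p
      refine lintegral_congr fun W => ?_
      rw [h]
      simp only [assemble_mulVec, trace_assemble, ← add_assoc]
      rfl

/-! ### Kronecker products -/

theorem kronMat_mulVec_kronVec {k d : ℕ} (W : Fin k → Matrix (Fin d) (Fin d) ℝ)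
    (x : Fin k → Fin d → ℝ) : kronMat W *ᵥ kronVec x = kronVec fun i => W i *ᵥ x i := by
  funext a
  simp only [Matrix.mulVec, dotProduct, kronMat, kronVec, Matrix.of_apply,
    ← Finset.prod_mul_distrib]
  rw [Finset.prod_univ_sum, Fintype.piFinset_univ]

theorem trace_kronMat {k d : ℕ} (W : Fin k → Matrix (Fin d) (Fin d) ℝ) :
    (kronMat W).trace = ∏ i, (W i).trace := by
  simp only [Matrix.trace, Matrix.diag, kronMat, Matrix.of_apply]
  rw [Finset.prod_univ_sum, Fintype.piFinset_univ]

theorem posSemidef_kronMat_gram {k d n : ℕ} (M : Fin k → Matrix (Fin n) (Fin d) ℝ) :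
    (kronMat fun i => (M i)ᵀ * M i).PosSemidef := by
  let K : Matrix (Fin k → Fin n) (Fin k → Fin d) ℝ := Matrix.of fun a b => ∏ i, M i (a i) (b i)
  have h : (kronMat fun i => (M i)ᵀ * M i) = Kᴴ * K := by
    ext a b
    simp only [kronMat, K, Matrix.of_apply, Matrix.mul_apply, Matrix.transpose_apply,
      Matrix.conjTranspose_apply, star_trivial, ← Finset.prod_mul_distrib]
    rw [Finset.prod_univ_sum, Fintype.piFinset_univ]
  rw [h]
  exact Matrix.posSemidef_conjTranspose_mul_self K

theorem measurable_kronMat {k d : ℕ} : Measurable (kronMat (k := k) (d := d)) :=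
  measurable_matrix fun a b => by
    simp only [kronMat, Matrix.of_apply]
    exact Finset.measurable_prod _ fun i _ => (measurable_pi_apply i).matrix_entry (a i) (b i)

theorem measurable_kronVec {k d : ℕ} : Measurable (kronVec (k := k) (d := d)) :=
  measurable_pi_iff.2 fun a => Finset.measurable_prod _ fun i _ =>
    measurable_pi_iff.1 (measurable_pi_apply i) (a i)

/-! ### Kronecker algorithms as adaptive estimators -/

namespace KronAlgorithm

variable {Ω : Type u} [MeasurableSpace Ω] {k d q : ℕ}

theorem measurable_cons {α E : Type*} [MeasurableSpace α] [MeasurableSpace E] {j : ℕ} {y : α → E}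
    {z : α → Fin j → E} (hy : Measurable y) (hz : Measurable z) :
    Measurable fun a => (Fin.cons (y a) (z a) : Fin (j + 1) → E) :=
  measurable_pi_iff.2 fun i => by
    refine Fin.cases ?_ (fun i => ?_) i
    · exact hy
    · exact measurable_pi_iff.1 hz i

/-- The first query, a function of the seed alone. -/
def firstQuery (alg : KronAlgorithm Ω k d (q + 1)) (ω : Ω) : Fin k → Fin d → ℝ :=
  alg.query 0 ω Fin.elim0

/-- The algorithm that remains after the first query, with the response to it joined to the
seed. -/
def afterFirst (alg : KronAlgorithm Ω k d (q + 1)) :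
    KronAlgorithm (Ω × ((Fin k → Fin d) → ℝ)) k d q where
  query j p past := alg.query j.succ p.1
    (Fin.cons p.2 past : Fin ((j : ℕ) + 1) → (Fin k → Fin d) → ℝ)
  output p past := alg.output p.1 (Fin.cons p.2 past : Fin (q + 1) → (Fin k → Fin d) → ℝ)
  measurable_query j := (alg.measurable_query j.succ).comp
    ((measurable_fst.comp measurable_fst).prodMk
      (measurable_cons (measurable_snd.comp measurable_fst) measurable_snd))
  measurable_output := alg.measurable_output.comp
    ((measurable_fst.comp measurable_fst).prodMk
      (measurable_cons (measurable_snd.comp measurable_fst) measurable_snd))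

theorem responses_step (alg : KronAlgorithm Ω k d q)
    (A : Matrix (Fin k → Fin d) (Fin k → Fin d) ℝ) (ω : Ω) (j : ℕ) (h : j + 1 ≤ q) :
    alg.responses A ω (j + 1) h =
      Fin.snoc (α := fun _ => (Fin k → Fin d) → ℝ) (alg.responses A ω j (Nat.le_of_succ_le h))
        (A *ᵥ kronVec (alg.query ⟨j, h⟩ ω (alg.responses A ω j (Nat.le_of_succ_le h)))) :=
  rfl

theorem responses_succ (alg : KronAlgorithm Ω k d (q + 1))
    (A : Matrix (Fin k → Fin d) (Fin k → Fin d) ℝ) (ω : Ω) (j : ℕ) (h : j ≤ q) :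
    alg.responses A ω (j + 1) (Nat.succ_le_succ h) =
      (Fin.cons (A *ᵥ kronVec (alg.firstQuery ω))
        (alg.afterFirst.responses A (ω, A *ᵥ kronVec (alg.firstQuery ω)) j h) :
        Fin (j + 1) → (Fin k → Fin d) → ℝ) := by
  induction j with
  | zero =>
    funext i
    refine Fin.cases ?_ (fun i => i.elim0) i
    rfl
  | succ j ih =>
    have ih' := ih (Nat.le_of_succ_le h)
    rw [responses_step alg A ω (j + 1), responses_step alg.afterFirst, ih', Fin.cons_snoc_eq_snoc_cons]
    rfl

theorem estimate_succ (alg : KronAlgorithm Ω k d (q + 1))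
    (A : Matrix (Fin k → Fin d) (Fin k → Fin d) ℝ) (ω : Ω) :
    alg.estimate A ω = alg.afterFirst.estimate A (ω, A *ᵥ kronVec (alg.firstQuery ω)) := by
  unfold estimate
  rw [alg.responses_succ A ω q le_rfl]
  rfl

theorem measurable_firstQuery (alg : KronAlgorithm Ω k d (q + 1)) : Measurable alg.firstQuery :=
  (alg.measurable_query 0).comp (measurable_id.prodMk measurable_const)

theorem measurable_estimate (alg : KronAlgorithm Ω k d q) :
    Measurable fun p : Matrix (Fin k → Fin d) (Fin k → Fin d) ℝ × Ω => alg.estimate p.1 p.2 := by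
  induction q generalizing Ω with
  | zero =>
    have h : Measurable fun ω => alg.output ω Fin.elim0 :=
      alg.measurable_output.comp (measurable_id.prodMk measurable_const)
    exact h.comp measurable_snd
  | succ q ih =>
    simp only [estimate_succ]
    have hy : Measurable fun p : Matrix (Fin k → Fin d) (Fin k → Fin d) ℝ × Ω =>
        p.1 *ᵥ kronVec (alg.firstQuery p.2) :=
      measurable_fst.matrix_mulVec
        (measurable_kronVec.comp (alg.measurable_firstQuery.comp measurable_snd))
    have h := (ih alg.afterFirst).comp (measurable_fst.prodMk (measurable_snd.prodMk hy))
    exact h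

/-- On a Kronecker product, the response to a Kronecker query is the Kronecker product of the
responses of the factors. -/
theorem isAdaptiveEstimator (alg : KronAlgorithm Ω k d q) :
    IsAdaptiveEstimator q fun ω (W : Fin k → Matrix (Fin d) (Fin d) ℝ) =>
      alg.estimate (kronMat W) ω := by
  induction q generalizing Ω with
  | zero => exact ⟨fun ω => alg.output ω Fin.elim0,
      alg.measurable_output.comp (measurable_id.prodMk measurable_const), fun ω W => rfl⟩
  | succ q ih =>
    have hφ : Measurable fun p : Ω × (Fin k → Fin d → ℝ) => (p.1, kronVec p.2) :=
      measurable_fst.prodMk (measurable_kronVec.comp measurable_snd)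
    have h := (ih alg.afterFirst).comp_congruence hφ
      (B := fun _ _ => 0) measurable_const
      (L := fun _ _ => (1 : Matrix (Fin d) (Fin d) ℝ)) measurable_const
    refine ⟨alg.firstQuery, alg.measurable_firstQuery, _, h, fun ω W => ?_⟩
    simp only [estimate_succ, kronMat_mulVec_kronVec, Matrix.transpose_one, Matrix.mul_one,
      Matrix.one_mul, zero_add]

end KronAlgorithm

/-! ### The number of queries -/

/-- If the relative error `1 - (1 - v / D)ᵏ` is at most `ε²`, then `k v / D` is of order `ε²`. -/
theorem mul_le_of_sub_pow_le {k : ℕ} {ε D v : ℝ} (hε : 0 < ε) (hε2 : ε < 1 / 2) (hD : 0 < D)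
    (hv : 0 ≤ v) (hvD : v ≤ D) (h : D ^ k - (D - v) ^ k ≤ ε ^ 2 * D ^ k) :
    3 * (k * v) ≤ 4 * ε ^ 2 * D := by
  have hbern : 1 + (k : ℝ) * (v / D) ≤ (1 + v / D) ^ k :=
    one_add_mul_le_pow (by have := div_nonneg hv hD.le; linarith) k
  have hy0 : 0 ≤ v / D := div_nonneg hv hD.le
  have hy1 : v / D ≤ 1 := (div_le_one hD).2 hvD
  have hpow : (D - v) ^ k = D ^ k * (1 - v / D) ^ k := by
    rw [← mul_pow]
    congr 1
    field_simp
  have hDk : 0 < D ^ k := pow_pos hD k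
  rw [hpow] at h
  have h1 : 1 - ε ^ 2 ≤ (1 - v / D) ^ k := by
    by_contra hc
    nlinarith [mul_lt_mul_of_pos_left (not_le.1 hc) hDk]
  -- With `y = v / D`: `(1 - y)ᵏ (1 + k y) ≤ (1 - y²)ᵏ ≤ 1`
  have h2 : (1 - v / D) ^ k * (1 + k * (v / D)) ≤ 1 := by
    calc (1 - v / D) ^ k * (1 + k * (v / D)) ≤ (1 - v / D) ^ k * (1 + v / D) ^ k :=
          mul_le_mul_of_nonneg_left hbern (pow_nonneg (by linarith) k)
      _ = (1 - (v / D) ^ 2) ^ k := by rw [← mul_pow]; ring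
      _ ≤ 1 := pow_le_one₀ (by nlinarith) (by nlinarith)
  have hky : 0 ≤ (k : ℝ) * (v / D) := by positivity
  have h3 : (1 - ε ^ 2) * (1 + k * (v / D)) ≤ 1 :=
    (mul_le_mul_of_nonneg_right h1 (by linarith)).trans h2
  have h4 : 3 * (k * (v / D)) ≤ 4 * ε ^ 2 := by
    have hε4 : ε ^ 2 ≤ 1 / 4 := by nlinarith
    linarith [mul_le_mul_of_nonneg_left hε4 hky]
  have h5 : v / D * D = v := div_mul_cancel₀ v hD.ne'
  calc 3 * (k * v) = 3 * (k * (v / D)) * D := by rw [← h5]; field_simp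
    _ ≤ 4 * ε ^ 2 * D := mul_le_mul_of_nonneg_right h4 hD.le

/-- The dimension of the hard instance. It is a fraction of `√k / ε`, so that the relative variance
of the trace, about `k / d²`, is a constant multiple of `ε²`. -/
noncomputable def hardDim (k : ℕ) (ε : ℝ) : ℕ := max 1 ⌊√(k : ℝ) / (3 * ε)⌋₊

theorem two_lt_sqrt_div {k : ℕ} {ε : ℝ} (hk : 1 ≤ k) (hε : 0 < ε) (hε2 : ε < 1 / 2) :
    2 < √(k : ℝ) / ε := by
  have h1 : 1 ≤ √(k : ℝ) := Real.one_le_sqrt.2 (by exact_mod_cast hk)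
  rw [lt_div_iff₀ hε]
  linarith

theorem hardDim_le {k : ℕ} {ε : ℝ} (hk : 1 ≤ k) (hε : 0 < ε) (hε2 : ε < 1 / 2) :
    (hardDim k ε : ℝ) ≤ √(k : ℝ) / ε := by
  have h := two_lt_sqrt_div hk hε hε2
  have h3 : √(k : ℝ) / (3 * ε) = √(k : ℝ) / ε / 3 := by rw [mul_comm, div_mul_eq_div_div]
  unfold hardDim
  rw [Nat.cast_max, max_le_iff]
  refine ⟨by push_cast; linarith, (Nat.floor_le (by positivity)).trans ?_⟩
  linarith

theorem lintegral_prod_trace_sq (k d : ℕ) :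
    ∫⁻ W : Fin k → Matrix (Fin d) (Fin d) ℝ, ENNReal.ofReal ((∏ i, (W i).trace) ^ 2)
      ∂(Measure.pi fun _ => wishart d) = ENNReal.ofReal (shiftedSecondMoment d 0 ^ k) := by
  obtain ⟨h1, h2⟩ := integral_prod_trace_sq (k := k) (n := d) 0
  simp only [Pi.zero_apply, zero_add, Finset.prod_const, Finset.card_univ, Fintype.card_fin]
    at h1 h2
  rw [← ofReal_integral_eq_lintegral_ofReal h1 (Filter.Eventually.of_forall fun W => sq_nonneg _),
    h2]

/-- An adaptive estimator that is accurate for Wishart matrices of dimension `hardDim k ε` makes many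
queries. -/
theorem IsAdaptiveEstimator.le_queries {k q : ℕ} {ε : ℝ} (hk : 1 ≤ k) (hε : 0 < ε)
    (hε2 : ε < 1 / 2) {S : Type*} [MeasurableSpace S] (P : Measure S) [IsProbabilityMeasure P]
    {f : S → (Fin k → Matrix (Fin (hardDim k ε)) (Fin (hardDim k ε)) ℝ) → ℝ}
    (hf : IsAdaptiveEstimator q f)
    (h : ∫⁻ s, ∫⁻ W, ENNReal.ofReal ((f s W - ∏ i, (W i).trace) ^ 2)
        ∂(Measure.pi fun _ => wishart (hardDim k ε)) ∂P ≤
      ENNReal.ofReal (ε ^ 2) * ∫⁻ W : Fin k → Matrix (Fin (hardDim k ε)) (Fin (hardDim k ε)) ℝ,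
        ENNReal.ofReal ((∏ i, (W i).trace) ^ 2) ∂(Measure.pi fun _ => wishart (hardDim k ε))) :
    1 / 12 * √(k : ℝ) / ε ≤ q := by
  by_contra! hq
  set r : ℝ := √(k : ℝ) / (3 * ε) with hr
  have hr0 : 0 ≤ r := by positivity
  have hqr : (q : ℝ) < r / 4 := by
    have h12 : r / 4 = 1 / 12 * √(k : ℝ) / ε := by
      rw [hr]
      field_simp
      norm_num
    rwa [h12]
  have hd1 : 1 ≤ hardDim k ε := le_max_left _ _
  have hkε : (k : ℝ) = 9 * ε ^ 2 * r ^ 2 := by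
    rw [hr, div_pow, Real.sq_sqrt (by positivity)]
    field_simp
    norm_num
  have hk1 : (1 : ℝ) ≤ k := by exact_mod_cast hk
  -- Either `d` is at most `r` and at least `r / 2`, or no query is made and `d = 1`.
  have hcase : (2 * q ≤ hardDim k ε ∧ (hardDim k ε : ℝ) ≤ r) ∨ (q = 0 ∧ hardDim k ε = 1) := by
    by_cases h1 : 1 ≤ ⌊r⌋₊
    · left
      have hd : hardDim k ε = ⌊r⌋₊ := max_eq_right h1
      have h2 : r < (⌊r⌋₊ : ℝ) + 1 := Nat.lt_floor_add_one r
      have h3 : (1 : ℝ) ≤ (⌊r⌋₊ : ℝ) := by exact_mod_cast h1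
      refine ⟨?_, hd ▸ Nat.floor_le hr0⟩
      rw [hd]
      have : (2 * q : ℝ) ≤ (⌊r⌋₊ : ℝ) := by linarith
      exact_mod_cast this
    · right
      have hr1 : r < 1 := by
        by_contra hc
        exact h1 (Nat.le_floor (by simpa using hc))
      refine ⟨?_, max_eq_left (not_le.1 h1).le⟩
      have : (q : ℝ) < 1 := by linarith
      exact_mod_cast Nat.lt_one_iff.1 (by exact_mod_cast this)
  have hle : 2 * q ≤ hardDim k ε := by
    rcases hcase with hc | hc
    · exact hc.1
    · omega
  generalize hardDim k ε = d at *
  obtain ⟨n, rfl⟩ : ∃ n, d = n + q := ⟨d - q, by omega⟩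
  have hbound := hf.errorBound_le rfl P (b := fun _ _ => 0) measurable_const
  simp only [zero_add, lintegral_const, measure_univ, mul_one] at hbound
  have hbound' := hbound.trans h
  rw [lintegral_prod_trace_sq, ← ENNReal.ofReal_mul (by positivity), ENNReal.ofReal_le_ofReal_iff
    (by unfold shiftedSecondMoment; positivity)] at hbound'
  simp only [errorBound, Finset.prod_const, Finset.card_univ, Fintype.card_fin] at hbound'
  have hn1 : (1 : ℝ) ≤ ((n + q : ℕ) : ℝ) := by exact_mod_cast hd1
  have hnd : (n : ℝ) ≤ ((n + q : ℕ) : ℝ) := by push_cast; linarith [Nat.cast_nonneg (α := ℝ) q]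
  have hn2 : ((n + q : ℕ) : ℝ) ≤ 2 * n := by
    have : n + q ≤ 2 * n := by omega
    exact_mod_cast this
  have hdr : ((n + q : ℕ) : ℝ) ≤ r ∨ (((n + q : ℕ) : ℝ) = 1 ∧ (n : ℝ) = 1) := by
    rcases hcase with hc | ⟨hc1, hc2⟩
    · exact Or.inl hc.2
    · refine Or.inr ⟨by exact_mod_cast hc2, ?_⟩
      have : n = 1 := by omega
      exact_mod_cast this
  generalize ((n + q : ℕ) : ℝ) = d at *
  have hn0 : (0 : ℝ) ≤ n := Nat.cast_nonneg n
  have hmain := mul_le_of_sub_pow_le hε hε2 (by unfold shiftedSecondMoment; positivity)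
    (by positivity) (by
      unfold shiftedSecondMoment
      nlinarith [pow_le_pow_left₀ hn0 hnd 2, sq_nonneg (0 + d ^ 2)]) hbound'
  have hS : shiftedSecondMoment d 0 = d ^ 4 + 2 * d ^ 2 := by unfold shiftedSecondMoment; ring
  rw [hS] at hmain
  rcases hdr with hdr | ⟨hd, hn⟩
  · have hdsq : 1 ≤ d ^ 2 := one_le_pow₀ hn1
    have h1 : d ^ 2 ≤ 4 * (n : ℝ) ^ 2 := by nlinarith
    have h2 : d ^ 2 ≤ r ^ 2 := pow_le_pow_left₀ (by linarith) hdr 2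
    have h3 : d ^ 4 + 2 * d ^ 2 ≤ 3 * d ^ 2 * d ^ 2 := by nlinarith
    have h4 : 3 * (k * (d ^ 2 / 2)) ≤ 4 * ε ^ 2 * (3 * d ^ 2 * d ^ 2) := by
      refine le_trans ?_ (hmain.trans (mul_le_mul_of_nonneg_left h3 (by positivity)))
      refine mul_le_mul_of_nonneg_left (mul_le_mul_of_nonneg_left ?_ (by positivity)) (by norm_num)
      linarith
    have h5 : (k : ℝ) ≤ 8 * ε ^ 2 * d ^ 2 := by
      by_contra hc
      nlinarith [mul_lt_mul_of_pos_right (not_le.1 hc) (by linarith : (0 : ℝ) < d ^ 2)]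
    have h6 : 8 * ε ^ 2 * d ^ 2 ≤ 8 * ε ^ 2 * r ^ 2 := mul_le_mul_of_nonneg_left h2 (by positivity)
    nlinarith
  · rw [hd, hn] at hmain
    nlinarith

theorem eLpNorm_two_sq {α : Type*} [MeasurableSpace α] (f : α → ℝ) (μ : Measure α) :
    eLpNorm f 2 μ ^ 2 = ∫⁻ x, ENNReal.ofReal (f x ^ 2) ∂μ := by
  have h := eLpNorm_nnreal_pow_eq_lintegral (f := f) (μ := μ) (p := 2) two_ne_zero
  simp only [NNReal.coe_ofNat, ENNReal.coe_ofNat] at h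
  rw [← ENNReal.rpow_natCast, Nat.cast_ofNat, h]
  refine lintegral_congr fun x => ?_
  rw [show (2 : ℝ) = ((2 : ℕ) : ℝ) by norm_num, ENNReal.rpow_natCast,
    Real.enorm_eq_ofReal_abs, ← ENNReal.ofReal_pow (abs_nonneg _), sq_abs]

/-- The embedding of `ℝ^n` into `ℝ^d` as the first `n` coordinates. -/
def embedInit (d n : ℕ) : Matrix (Fin d) (Fin n) ℝ :=
  Matrix.of fun i j => if (i : ℕ) = j then 1 else 0

theorem embedInit_transpose_mul {d n : ℕ} (h : n ≤ d) : (embedInit d n)ᵀ * embedInit d n = 1 := by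
  ext i j
  rw [Matrix.mul_apply, Finset.sum_eq_single (Fin.castLE h i)]
  · simp [embedInit, Matrix.one_apply, Fin.ext_iff]
  · intro b _ hb
    have : (b : ℕ) ≠ i := fun hc => hb (Fin.ext hc)
    simp [embedInit, this]
  · simp

theorem measurable_sq_error {k n q : ℕ} {S : Type*} [MeasurableSpace S]
    {f : S → (Fin k → Matrix (Fin n) (Fin n) ℝ) → ℝ} (hf : IsAdaptiveEstimator q f) :
    Measurable fun p : S × (Fin k → Matrix (Fin n) (Fin n) ℝ) =>
      ENNReal.ofReal ((f p.1 p.2 - ∏ i, (p.2 i).trace) ^ 2) := by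
  have ht : Measurable fun p : S × (Fin k → Matrix (Fin n) (Fin n) ℝ) => ∏ i, (p.2 i).trace :=
    Finset.measurable_prod _ fun i _ => ((measurable_pi_apply i).comp measurable_snd).matrix_trace
  exact ((hf.measurable.sub ht).pow_const 2).ennreal_ofReal

/-- Padding with zeros turns an algorithm for dimension `d` into an estimator for the hard instance,
and the worst-case error bound can be averaged over it. -/
theorem KronAlgorithm.le_queries_of_posSemidef {k d q : ℕ} {ε : ℝ} (hk : 1 ≤ k) (hε : 0 < ε)
    (hε2 : ε < 1 / 2) (hd : √(k : ℝ) / ε ≤ d) {Ω : Type*} [MeasurableSpace Ω] (P : Measure Ω)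
    [IsProbabilityMeasure P] (alg : KronAlgorithm Ω k d q)
    (h : ∀ A : Matrix (Fin k → Fin d) (Fin k → Fin d) ℝ, A.PosSemidef →
      eLpNorm (fun ω => alg.estimate A ω - A.trace) 2 P ≤ ENNReal.ofReal (ε * A.trace)) :
    1 / 12 * √(k : ℝ) / ε ≤ q := by
  have hnd : hardDim k ε ≤ d := by exact_mod_cast (hardDim_le hk hε hε2).trans hd
  have hL := embedInit_transpose_mul hnd
  have hf := alg.isAdaptiveEstimator.comp_congruence (φ := id) measurable_id
    (B := fun _ _ => 0) measurable_const (L := fun _ _ => embedInit d (hardDim k ε))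
    measurable_const
  simp only [zero_add, id] at hf
  refine hf.le_queries hk hε hε2 P ?_
  have hm := measurable_sq_error hf
  have hmp : MeasurePreserving
      (fun (G : Fin k → Matrix (Fin (hardDim k ε)) (Fin (hardDim k ε)) ℝ) i => (G i)ᵀ * G i)
      (Measure.pi fun _ => gaussianMatrix (hardDim k ε))
      (Measure.pi fun _ => wishart (hardDim k ε)) :=
    measurePreserving_pi (fun _ : Fin k => gaussianMatrix (hardDim k ε))
      (fun _ : Fin k => wishart (hardDim k ε)) fun _ => ⟨measurable_gram, rfl⟩
  have ht : Measurable fun W : Fin k → Matrix (Fin (hardDim k ε)) (Fin (hardDim k ε)) ℝ =>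
      ENNReal.ofReal ((∏ i, (W i).trace) ^ 2) :=
    ((Finset.measurable_prod _ fun i _ => (measurable_pi_apply i).matrix_trace).pow_const
      2).ennreal_ofReal
  rw [lintegral_lintegral_swap hm.aemeasurable, ← hmp.lintegral_comp hm.lintegral_prod_left',
    ← hmp.lintegral_comp ht]
  refine le_trans (lintegral_mono fun G => ?_)
    (lintegral_const_mul (ENNReal.ofReal (ε ^ 2)) (ht.comp hmp.measurable)).le
  have hA := h _ (posSemidef_kronMat_gram fun i => G i * (embedInit d (hardDim k ε))ᵀ)
  have hgram : (fun i => (G i * (embedInit d (hardDim k ε))ᵀ)ᵀ *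
      (G i * (embedInit d (hardDim k ε))ᵀ)) =
      fun i => embedInit d (hardDim k ε) * ((G i)ᵀ * G i) * (embedInit d (hardDim k ε))ᵀ := by
    funext i
    simp only [Matrix.transpose_mul, Matrix.transpose_transpose, Matrix.mul_assoc]
  have htr : (kronMat fun i => embedInit d (hardDim k ε) * ((G i)ᵀ * G i) *
      (embedInit d (hardDim k ε))ᵀ).trace = ∏ i, ((G i)ᵀ * G i).trace := by
    rw [trace_kronMat]
    refine Finset.prod_congr rfl fun i _ => ?_
    rw [Matrix.trace_mul_comm, ← Matrix.mul_assoc, hL, Matrix.one_mul]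
  rw [hgram, htr] at hA
  have hA2 := pow_le_pow_left₀ zero_le hA 2
  have hpos : 0 ≤ ∏ i, ((G i)ᵀ * G i).trace := Finset.prod_nonneg fun i _ => by
    rw [trace_transpose_mul_self]
    positivity
  rw [eLpNorm_two_sq, ← ENNReal.ofReal_pow (by positivity), mul_pow,
    ENNReal.ofReal_mul (by positivity)] at hA2
  exact hA2

instance {k d : ℕ} : IsProbabilityMeasure (kronWishart k d) :=
  Measure.isProbabilityMeasure_map measurable_kronMat.aemeasurable

theorem KronAlgorithm.le_queries_of_kronWishart {k q : ℕ} {ε : ℝ} (hk : 1 ≤ k) (hε : 0 < ε)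
    (hε2 : ε < 1 / 2) {Ω : Type*} [MeasurableSpace Ω] (P : Measure Ω)
    [IsProbabilityMeasure P] (alg : KronAlgorithm Ω k (hardDim k ε) q)
    (h : eLpNorm (fun p : Matrix (Fin k → Fin (hardDim k ε)) (Fin k → Fin (hardDim k ε)) ℝ × Ω =>
        alg.estimate p.1 p.2 - p.1.trace) 2 ((kronWishart k (hardDim k ε)).prod P) ≤
      ENNReal.ofReal ε *
        eLpNorm (fun A : Matrix (Fin k → Fin (hardDim k ε)) (Fin k → Fin (hardDim k ε)) ℝ =>
          A.trace) 2 (kronWishart k (hardDim k ε))) :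
    1 / 12 * √(k : ℝ) / ε ≤ q := by
  have hf := alg.isAdaptiveEstimator
  refine hf.le_queries hk hε hε2 P ?_
  have hm := measurable_sq_error hf
  have h2 := pow_le_pow_left₀ zero_le h 2
  have htr : Measurable fun A : Matrix (Fin k → Fin (hardDim k ε)) (Fin k → Fin (hardDim k ε)) ℝ =>
      A.trace := measurable_id.matrix_trace
  have herr : Measurable
      fun p : Matrix (Fin k → Fin (hardDim k ε)) (Fin k → Fin (hardDim k ε)) ℝ × Ω =>
        ENNReal.ofReal ((alg.estimate p.1 p.2 - p.1.trace) ^ 2) :=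
    ((alg.measurable_estimate.sub (htr.comp measurable_fst)).pow_const 2).ennreal_ofReal
  rw [mul_pow, eLpNorm_two_sq, eLpNorm_two_sq, ← ENNReal.ofReal_pow hε.le,
    lintegral_prod _ herr.aemeasurable, kronWishart,
    lintegral_map herr.lintegral_prod_right' measurable_kronMat,
    lintegral_map (htr.pow_const 2).ennreal_ofReal measurable_kronMat] at h2
  simp only [trace_kronMat] at h2
  rwa [lintegral_lintegral_swap hm.aemeasurable]

/-! ### The lower bounds -/

theorem mainTheorem9 :
    ∃ c : ℝ, 0 < c ∧ ∀ (k : ℕ) (ε : ℝ), 1 ≤ k → 0 < ε → ε < 1 / 2 →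
      -- worst case over positive semidefinite inputs
      (∀ d : ℕ, √(k : ℝ) / ε ≤ d →
        ∀ (Ω : Type*) [MeasurableSpace Ω] (P : Measure Ω) [IsProbabilityMeasure P]
          (q : ℕ) (alg : KronAlgorithm Ω k d q),
          (∀ A : Matrix (Fin k → Fin d) (Fin k → Fin d) ℝ, A.PosSemidef →
            eLpNorm (fun ω => alg.estimate A ω - A.trace) 2 P ≤ ENNReal.ofReal (ε * A.trace)) →
          c * √(k : ℝ) / ε ≤ q) ∧
      -- the hard instance: on average over a Kronecker product of independent Wishart matrices
      (∃ d : ℕ, (d : ℝ) ≤ √(k : ℝ) / ε ∧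
        ∀ (Ω : Type*) [MeasurableSpace Ω] (P : Measure Ω) [IsProbabilityMeasure P]
          (q : ℕ) (alg : KronAlgorithm Ω k d q),
          eLpNorm (fun p : Matrix (Fin k → Fin d) (Fin k → Fin d) ℝ × Ω =>
              alg.estimate p.1 p.2 - p.1.trace) 2 ((kronWishart k d).prod P) ≤
            ENNReal.ofReal ε *
              eLpNorm (fun A : Matrix (Fin k → Fin d) (Fin k → Fin d) ℝ => A.trace) 2
                (kronWishart k d) →
          c * √(k : ℝ) / ε ≤ q) := by
  refine ⟨1 / 12, by norm_num, fun k ε hk hε hε2 => ⟨?_, hardDim k ε, hardDim_le hk hε hε2, ?_⟩⟩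
  · intro d hd Ω _ P _ q alg h
    exact alg.le_queries_of_posSemidef hk hε hε2 hd P h
  · intro Ω _ P _ q alg h
    exact alg.le_queries_of_kronWishart hk hε hε2 P h
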